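/- Let $d,d'\ge 0$ and $N,M\ge 2$ be integers, let $a\in\mathbb R\setminus\{0\}$, let $B_1\in\mathbb R^{d\times d}$, $B_2\in\mathbb R^{d\times d'}$, $C\in\mathbb R^{d'\times d'}$ with $1\notin\operatorname{Spec} C$, and let $F:U\to\mathbb R\times\mathbb R^d\times\mathbb R^{d'}$ be a real analytic map on an open neighbourhood $U\subset\mathbb R\times\mathbb R^d\times\mathbb R^{d'}$ of the origin, of the form $$ F\begin{pmatrix}x\\y\\z\end{pmatrix}=\begin{pmatrix} x-ax^N+f_N(x,y,z)+f_{\ge N+1}(x,y,z)\\ y+x^{M-1}B_1y+x^{M-1}B_2z+g_M(x,y,z)+g_{\ge M+1}(x,y,z)\\ Cz+h_{\ge 2}(x,y,z)\end{pmatrix}, $$ where $f_N$ is a homogeneous polynomial of degree $N$ with $f_N(x,0,0)=0$; $g_M$ is an $\mathbb R^d$-valued homogeneous polynomial of degree $M$ with $g_M(x,0,0)=0$, $D_yg_M(x,0,0)=0$ and $D_zg_M(x,0,0)=0$; and $f_{\ge N+1}$, $g_{\ge M+1}$, $h_{\ge 2}$ have orders $N+1$, $M+1$, $2$ at the origin (a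 function has order $k$ if it and its derivatives vanish at $0$ up to order $k-1$). Suppose that $B_1$ is invertible if $M<N$, and that $B_1+la\,\mathrm{Id}$ is invertible for every integer $l\ge 2$ if $M=N$ (nothing is required of $B_1$ if $M>N$). Then there is a unique polynomial of the form $R(t)=t-at^N+bt^{2N-1}$, $b\in\mathbb R$, such that for every $c\in\mathbb R$ there is a unique formal power series $\hat K(t)=\sum_{n\ge 0}K_nt^n$ with coefficients in $\mathbb R\times\mathbb R^d\times\mathbb R^{d'}$, with $K_0=0$, $K_1=(1,0,0)$ and with the $x$-component of $K_N$ equal to $c$, that satisfies $F\circ\hat K=\hat K\circ R$ in the sense of composition of formal power series ($F$ being replaced by its Taylor series at $0$). Moreover, with this $R$, for every $c$ the series $\hat K$ is $\gamma$-Gevrey, where $\gamma=\frac1{N-1}$ if $N\le M$ and $\gamma=\frac1{N-M}$ if $N>M$: there are constants $c_1,c_2>0$ such that $\|K_n\|\le c_1c_2^n\,n!^{\gamma}$ for all $n\ge 0$, where $\|\cdot\|$ is the maximum norm (equivalently, any norm). -/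

import Mathlib

open scoped Nat

noncomputable section

/-- The phase space `ℝ × ℝ^d × ℝ^{d'}` with coordinates `(x, y, z)`. -/
abbrev Phase (d d' : ℕ) : Type := ℝ × (Fin d → ℝ) × (Fin d' → ℝ)

/-- Index set of the coordinates `(x, y, z)`: one `x`, `d` many `y`'s, `d'` many `z`'s. -/
abbrev Coord (d d' : ℕ) : Type := Unit ⊕ Fin d ⊕ Fin d'

/-- The coordinates of a point of phase space, as a point at which polynomials are evaluated. -/
def Phase.coords {d d' : ℕ} (p : Phase d d') : Coord d d' → ℝ :=
  Sum.elim (fun _ => p.1) (Sum.elim p.2.1 p.2.2)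

/-- `f` has order `k` at the origin: `f` and its derivatives vanish up to order `k - 1` at `0`.
It is only used for functions that are analytic at `0`. -/
def HasOrderAtZero {E G : Type*} [NormedAddCommGroup E] [NormedSpace ℝ E]
    [NormedAddCommGroup G] [NormedSpace ℝ G] (k : ℕ) (f : E → G) : Prop :=
  ∀ j < k, iteratedFDeriv ℝ j f 0 = 0

/-- `F` is real analytic on the open neighbourhood `U` of the origin, and there it has the form
`x ↦ x - a x^N + f_N + f_{≥ N+1}`,
`y ↦ y + x^{M-1} B₁ y + x^{M-1} B₂ z + g_M + g_{≥ M+1}`,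
`z ↦ C z + h_{≥ 2}`,
where `f_N` and `g_M` are homogeneous polynomials of degrees `N` and `M`, with
`f_N(x,0,0) = 0`, `g_M(x,0,0) = 0`, `D_y g_M(x,0,0) = 0`, `D_z g_M(x,0,0) = 0`, and
`f_{≥ N+1}`, `g_{≥ M+1}`, `h_{≥ 2}` have orders `N + 1`, `M + 1`, `2` at the origin. -/
structure HasSystemForm {d d' : ℕ} (N M : ℕ) (a : ℝ)
    (B₁ : Matrix (Fin d) (Fin d) ℝ) (B₂ : Matrix (Fin d) (Fin d') ℝ)
    (C : Matrix (Fin d') (Fin d') ℝ)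
    (U : Set (Phase d d')) (F : Phase d d' → Phase d d') : Prop where
  isOpen : IsOpen U
  zero_mem : (0 : Phase d d') ∈ U
  analytic : AnalyticOnNhd ℝ F U
  expansion :
    ∃ (fN : MvPolynomial (Coord d d') ℝ) (gM : Fin d → MvPolynomial (Coord d d') ℝ)
      (f : Phase d d' → ℝ) (g : Phase d d' → Fin d → ℝ) (h : Phase d d' → Fin d' → ℝ),
      fN.IsHomogeneous N ∧
      (∀ x : ℝ, MvPolynomial.eval (Phase.coords ((x, 0, 0) : Phase d d')) fN = 0) ∧
      (∀ i, (gM i).IsHomogeneous M) ∧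
      (∀ i, ∀ x : ℝ, MvPolynomial.eval (Phase.coords ((x, 0, 0) : Phase d d')) (gM i) = 0) ∧
      (∀ i, ∀ j : Fin d, ∀ x : ℝ, MvPolynomial.eval (Phase.coords ((x, 0, 0) : Phase d d'))
        (MvPolynomial.pderiv (Sum.inr (Sum.inl j)) (gM i)) = 0) ∧
      (∀ i, ∀ j : Fin d', ∀ x : ℝ, MvPolynomial.eval (Phase.coords ((x, 0, 0) : Phase d d'))
        (MvPolynomial.pderiv (Sum.inr (Sum.inr j)) (gM i)) = 0) ∧
      HasOrderAtZero (N + 1) f ∧ HasOrderAtZero (M + 1) g ∧ HasOrderAtZero 2 h ∧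
      ∀ (x : ℝ) (y : Fin d → ℝ) (z : Fin d' → ℝ), ((x, y, z) : Phase d d') ∈ U →
        F (x, y, z) =
          (x - a * x ^ N + MvPolynomial.eval (Phase.coords (x, y, z)) fN + f (x, y, z),
           y + x ^ (M - 1) • B₁.mulVec y + x ^ (M - 1) • B₂.mulVec z
             + (fun i => MvPolynomial.eval (Phase.coords (x, y, z)) (gM i)) + g (x, y, z),
           C.mulVec z + h (x, y, z))

/-- The Taylor series of `F` at the origin, with terms `D^n F(0) / n!`. -/
def taylorAtZero {E G : Type*} [NormedAddCommGroup E] [NormedSpace ℝ E]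
    [NormedAddCommGroup G] [NormedSpace ℝ G] (F : E → G) : FormalMultilinearSeries ℝ E G :=
  fun n => (n ! : ℝ)⁻¹ • iteratedFDeriv ℝ n F 0

/-- The formal series `∑ W_n t^n` in one variable `t` with coefficients `W_n` in `E`. -/
def formalSeries {E : Type*} [NormedAddCommGroup E] [NormedSpace ℝ E] (W : ℕ → E) :
    FormalMultilinearSeries ℝ ℝ E :=
  fun n => ContinuousMultilinearMap.mkPiRing ℝ (Fin n) (W n)

/-- `K = ∑ K_n t^n` satisfies `F ∘ K = K ∘ R` in the sense of composition of formal series.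
(Formal composition presupposes that the inner series have no constant term.) -/
def FormalInvariance {E : Type*} [NormedAddCommGroup E] [NormedSpace ℝ E]
    (F : E → E) (R : Polynomial ℝ) (K : ℕ → E) : Prop :=
  (taylorAtZero F).comp (formalSeries K) = (formalSeries K).comp (formalSeries R.coeff)

/-- `K = ∑ K_n t^n` solves `F ∘ K = K ∘ R` formally, with `K_0 = 0`, `K_1 = (1,0,0)` and
`K_N^x = c`. -/
def IsFormalSolution {d d' : ℕ} (F : Phase d d' → Phase d d') (R : Polynomial ℝ)
    (N : ℕ) (c : ℝ) (K : ℕ → Phase d d') : Prop :=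
  K 0 = 0 ∧ K 1 = (1, 0, 0) ∧ (K N).1 = c ∧ FormalInvariance F R K

/-- `R` is of the form `t - a t^N + b t^(2N-1)`, and for every `c` there is a unique formal
solution `K` with `K_0 = 0`, `K_1 = (1,0,0)` and `K_N^x = c`. -/
def IsReparametrization {d d' : ℕ} (F : Phase d d' → Phase d d') (N : ℕ) (a : ℝ)
    (R : Polynomial ℝ) : Prop :=
  (∃ b : ℝ, R = Polynomial.X - Polynomial.C a * Polynomial.X ^ N
      + Polynomial.C b * Polynomial.X ^ (2 * N - 1)) ∧
    ∀ c : ℝ, ∃! K : ℕ → Phase d d', IsFormalSolution F R N c K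

/-- The Gevrey exponent: `1/(N-1)` if `N ≤ M`, and `1/(N-M)` if `N > M`. -/
def gevreyExponent (N M : ℕ) : ℝ :=
  if N ≤ M then 1 / ((N : ℝ) - 1) else 1 / ((N : ℝ) - (M : ℝ))

/-- The formal series `∑ K_n t^n` is `γ`-Gevrey. -/
def IsGevrey {E : Type*} [NormedAddCommGroup E] (γ : ℝ) (K : ℕ → E) : Prop :=
  ∃ c₁ > (0 : ℝ), ∃ c₂ > (0 : ℝ), ∀ n : ℕ, ‖K n‖ ≤ c₁ * c₂ ^ n * (n ! : ℝ) ^ γ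

end

/-! Compare coefficients in the form `(F - id) ∘ K = K ∘ R - K`. The x-, y- and z-components of `F -
id` start at orders `N`, `M` and `1`, and in a component of order `m ≤ N` the coefficient `K_n`
first appears at `t^(n+m-1)`, where it enters linearly. The case `M > N` is absorbed into `M = N`
with `B₁ = B₂ = 0` (`exists_isSystemJet`). The equations for `n ≥ 2` are then triangular: z is
solved through `C - 1`, then y through `B₁` (plus `n a Id` if `M = N`), then x through `(n - N) a`.

Only the x-equation at `n = N` degenerates. There `K_N^x` is free, which is the parameter `c`, and a
scalar condition remains. It sees the `K_j` with `j < N` and the (y,z)-part of `K_N`, none of which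
depends on `b` or `c`, while `b` itself enters with coefficient `-1` through `r_(2N-1) K_1`. Hence
exactly one `b` works, the same for all `c` (`solution_iff`, `resonance_add_eq`).

For the Gevrey bound put `u_n = ‖K_n‖ / (n!)^γ`. The terms coming from `F` are harmless: the product
of the factorials of the indices involved is at most `n!`, so they behave as in a convergent
problem. The loss comes from `K ∘ R`: the coefficient of `t^k` in `R^j` is bounded by a constant
times `k^((k-j)/(N-1))`. For `m = N` this contains an excess factor of size `n`, recovered by
dividing by a linear part of size `n`; for `m = M < N` nothing is recovered, which forces `γ =
1/(N-M)`. So `u_n` is bounded by a geometric convolution plus nonlinear majorants of earlier terms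
(`norm_invResidual_truncSeq_le`), and `exists_geometric_bound` concludes that `u_n` grows at most
geometrically. -/

noncomputable section

/-! ### Tuples of positive integers and compositions -/

/-- The `l`-tuples of positive integers with sum `k`. -/
def tuples (l k : ℕ) : Finset (Fin l → ℕ) :=
  (Fintype.piFinset fun _ : Fin l => Finset.Icc 1 k).filter fun f => ∑ i, f i = k

theorem mem_tuples {l k : ℕ} {f : Fin l → ℕ} :
    f ∈ tuples l k ↔ (∀ i, 1 ≤ f i) ∧ ∑ i, f i = k := by
  simp only [tuples, Finset.mem_filter, Fintype.mem_piFinset, Finset.mem_Icc]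
  constructor
  · rintro ⟨h, h'⟩
    exact ⟨fun i => (h i).1, h'⟩
  · rintro ⟨h, h'⟩
    refine ⟨fun i => ⟨h i, ?_⟩, h'⟩
    rw [← h']
    exact Finset.single_le_sum (f := f) (fun _ _ => Nat.zero_le _) (Finset.mem_univ i)

theorem length_le_of_mem_tuples {l k : ℕ} {f : Fin l → ℕ} (hf : f ∈ tuples l k) : l ≤ k := by
  obtain ⟨h, h'⟩ := mem_tuples.1 hf
  calc l = ∑ _i : Fin l, 1 := by simp
    _ ≤ ∑ i, f i := Finset.sum_le_sum fun i _ => h i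
    _ = k := h'

/-- The excesses `f i - 1` are the natural bookkeeping: an `l`-tuple of sum `n + m - 1` has total
excess `n - 1 - (l - m)`, so a longer tuple has only smaller entries. -/
theorem sum_pred_of_mem_tuples {l k : ℕ} {f : Fin l → ℕ} (hf : f ∈ tuples l k) :
    ∑ i, (f i - 1) + l = k := by
  obtain ⟨h, h'⟩ := mem_tuples.1 hf
  calc ∑ i, (f i - 1) + l = ∑ i, ((f i - 1) + 1) := by simp [Finset.sum_add_distrib]
    _ = ∑ i, f i := Finset.sum_congr rfl fun i _ => Nat.sub_add_cancel (h i)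
    _ = k := h'

theorem entry_add_length_le {l k : ℕ} {f : Fin l → ℕ} (hf : f ∈ tuples l k) (i : Fin l) :
    f i + l ≤ k + 1 := by
  have h := sum_pred_of_mem_tuples hf
  have h1 : f i - 1 ≤ ∑ i, (f i - 1) := Finset.single_le_sum (f := fun i => f i - 1) (fun _ _ => Nat.zero_le _)
    (Finset.mem_univ i)
  have h2 := (mem_tuples.1 hf).1 i
  omega

theorem tuples_eq_empty {l k : ℕ} (h : k < l) : tuples l k = ∅ := by
  ext f
  simp only [Finset.notMem_empty, iff_false]
  intro hf
  exact absurd (length_le_of_mem_tuples hf) (by omega)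

theorem tuples_self (l : ℕ) : tuples l l = {fun _ => 1} := by
  ext f
  rw [Finset.mem_singleton]
  constructor
  · intro hf
    funext i
    have := entry_add_length_le hf i
    have := (mem_tuples.1 hf).1 i
    omega
  · rintro rfl
    exact mem_tuples.2 ⟨fun _ => le_rfl, by simp⟩

theorem tuples_one {k : ℕ} (hk : 1 ≤ k) : tuples 1 k = {fun _ => k} := by
  ext f
  rw [Finset.mem_singleton, mem_tuples]
  constructor
  · rintro ⟨_, h⟩
    funext i
    rw [← h, Subsingleton.elim i 0]
    simp
  · rintro rfl
    exact ⟨fun _ => hk, by simp⟩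

/-- A tuple of length `m` and sum `n + m - 1` has all its entries below `n`, unless it consists of
one entry `n` and ones. -/
theorem sum_tuples_top {α : Type*} [AddCommMonoid α] {m n : ℕ} (hm : 1 ≤ m) (hn : 2 ≤ n)
    (G : (Fin m → ℕ) → α) :
    ∑ f ∈ tuples m (n + m - 1), G f =
      ∑ f ∈ (tuples m (n + m - 1)).filter (fun f => ∀ i, f i < n), G f +
        ∑ i, G (Function.update (fun _ => 1) i n) := by
  classical
  rw [← Finset.sum_filter_add_sum_filter_not (tuples m (n + m - 1)) (fun f => ∀ i, f i < n)]
  congr 1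
  symm
  refine Finset.sum_bij (fun i _ => Function.update (fun _ => 1) i n) ?_ ?_ ?_ ?_
  · intro i _
    rw [Finset.mem_filter, mem_tuples]
    refine ⟨⟨fun j => ?_, ?_⟩, ?_⟩
    · by_cases h : j = i
      · subst h; simp; omega
      · simp [h]
    · rw [Finset.sum_update_of_mem (Finset.mem_univ i)]
      simp [Finset.card_sdiff]
      omega
    · push Not
      exact ⟨i, by simp⟩
  · intro i _ j _ h
    by_contra hij
    have := congrFun h i
    simp [hij] at this
    omega
  · intro f hf
    rw [Finset.mem_filter] at hf
    obtain ⟨hf, h⟩ := hf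
    push Not at h
    obtain ⟨i, hi⟩ := h
    -- An entry `≥ n` uses up the whole excess `n - 1`, so it equals `n` and every other entry is
    -- one.
    have h1 := entry_add_length_le hf i
    have h2 := sum_pred_of_mem_tuples hf
    rw [← Finset.add_sum_erase _ _ (Finset.mem_univ i)] at h2
    have h3 : ∑ x ∈ Finset.univ.erase i, (f x - 1) = 0 := by omega
    rw [Finset.sum_eq_zero_iff] at h3
    refine ⟨i, Finset.mem_univ _, ?_⟩
    funext j
    by_cases h : j = i
    · subst h; simp; omega
    · have h4 := h3 j (by simp [h])
      have h5 := (mem_tuples.1 hf).1 j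
      simp [h]; omega
  · intro i _
    rfl

/-- Bridge from composition of formal multilinear series, which is indexed by `Composition k`, to
sums over tuples. -/
theorem sum_composition {α : Type*} [AddCommMonoid α] (k : ℕ) (G : (l : ℕ) → (Fin l → ℕ) → α) :
    ∑ c : Composition k, G c.length c.blocksFun =
      ∑ l ∈ Finset.range (k + 1), ∑ f ∈ tuples l k, G l f := by
  rw [Finset.sum_sigma']
  refine Finset.sum_bij (fun c _ => (⟨c.length, c.blocksFun⟩ : Σ l : ℕ, (Fin l → ℕ))) ?_ ?_ ?_ ?_
  · intro c _
    rw [Finset.mem_sigma, mem_tuples, Finset.mem_range]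
    exact ⟨Nat.lt_succ_of_le c.length_le, fun i => c.one_le_blocksFun i, c.sum_blocksFun⟩
  · intro c _ c' _ h
    apply Composition.ext
    rw [← c.ofFn_blocksFun, ← c'.ofFn_blocksFun]
    exact congrArg (fun x : Σ l : ℕ, (Fin l → ℕ) => List.ofFn x.2) h
  · rintro ⟨l, f⟩ h
    rw [Finset.mem_sigma, mem_tuples] at h
    obtain ⟨_, h1, h2⟩ := h
    let c : Composition k := ⟨List.ofFn f, by
      intro i hi
      rw [List.mem_ofFn] at hi
      obtain ⟨j, rfl⟩ := hi
      exact h1 j, by rw [List.sum_ofFn, h2]⟩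
    refine ⟨c, Finset.mem_univ _, ?_⟩
    have hl : c.length = l := by simp [c, Composition.length]
    refine Sigma.ext hl ?_
    refine (Fin.heq_fun_iff hl).2 ?_
    intro i
    simp [c, Composition.blocksFun]
  · intro c _
    rfl

/-! ### Coefficients of the invariance equation -/

section Residual

variable {V W : Type*} [NormedAddCommGroup V] [NormedSpace ℝ V]
  [NormedAddCommGroup W] [NormedSpace ℝ W]

/-- The coefficient of `t ^ k` in the composition of the series `p` with `∑ K_n t^n`. -/
def compCoeff (p : FormalMultilinearSeries ℝ V W) (K : ℕ → V) (k : ℕ) : W :=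
  ∑ l ∈ Finset.range (k + 1), ∑ f ∈ tuples l k, p l fun i => K (f i)

/-- The coefficient of `t ^ k` in `(∑ r_n t^n) ^ j`, when `r_0 = 0`. -/
def powCoeff (r : ℕ → ℝ) (k j : ℕ) : ℝ :=
  ∑ f ∈ tuples j k, ∏ i, r (f i)

/-- The coefficient of `t ^ k` in `p ∘ K - π ∘ (K ∘ r - K)`. -/
def invResidual (p : FormalMultilinearSeries ℝ V W) (π : V →L[ℝ] W) (r : ℕ → ℝ) (K : ℕ → V)
    (k : ℕ) : W :=
  compCoeff p K k -
    ∑ j ∈ Finset.range (k + 1), (powCoeff r k j - if j = k then 1 else 0) • π (K j)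

theorem comp_formalSeries_apply_one (p : FormalMultilinearSeries ℝ V W) (K : ℕ → V) (k : ℕ) :
    (p.comp (formalSeries K)) k (fun _ => 1) = compCoeff p K k := by
  rw [compCoeff, ← sum_composition k fun l f => p l fun i => K (f i)]
  simp only [FormalMultilinearSeries.comp, sum_apply,
    FormalMultilinearSeries.compAlongComposition_apply]
  refine Finset.sum_congr rfl fun c _ => ?_
  congr 1
  funext i
  simp [FormalMultilinearSeries.applyComposition, formalSeries]

theorem compCoeff_formalSeries (K : ℕ → V) (r : ℕ → ℝ) (k : ℕ) :
    compCoeff (formalSeries K) r k =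
      ∑ j ∈ Finset.range (k + 1), powCoeff r k j • K j := by
  simp [compCoeff, powCoeff, formalSeries, Finset.sum_smul]

theorem compCoeff_sub (p q : FormalMultilinearSeries ℝ V W) (K : ℕ → V) (k : ℕ) :
    compCoeff (p - q) K k = compCoeff p K k - compCoeff q K k := by
  simp [compCoeff]

theorem compCoeff_id (K : ℕ → V) (hK : K 0 = 0) (k : ℕ) :
    compCoeff (FormalMultilinearSeries.id ℝ V 0) K k = K k := by
  rw [← comp_formalSeries_apply_one, FormalMultilinearSeries.id_comp' (formalSeries K) 0 0
    (by simp [formalSeries, hK])]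
  simp [formalSeries]

theorem compCoeff_clm (π : V →L[ℝ] W) (p : FormalMultilinearSeries ℝ V V) (K : ℕ → V) (k : ℕ) :
    compCoeff (π.compFormalMultilinearSeries p) K k = π (compCoeff p K k) := by
  simp [compCoeff]

theorem invResidual_clm (π : V →L[ℝ] W) (p : FormalMultilinearSeries ℝ V V) (r : ℕ → ℝ) (K : ℕ → V)
    (k : ℕ) : invResidual (π.compFormalMultilinearSeries p) π r K k =
      π (invResidual p (ContinuousLinearMap.id ℝ V) r K k) := by
  simp [invResidual, compCoeff_clm]

/-- A multilinear map on `ℝ` is determined by its value at `(1, …, 1)`, so equality of the two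
compositions is equality of scalar-variable coefficients. Subtracting the identity from both sides
makes the orders `N`, `M`, `1` visible. -/
theorem formalInvariance_iff (F : V → V) (R : Polynomial ℝ) (K : ℕ → V) (hK : K 0 = 0) :
    FormalInvariance F R K ↔
      ∀ k, invResidual (taylorAtZero F - FormalMultilinearSeries.id ℝ V 0)
        (ContinuousLinearMap.id ℝ V) R.coeff K k = 0 := by
  have h : ∀ k, invResidual (taylorAtZero F - FormalMultilinearSeries.id ℝ V 0)
        (ContinuousLinearMap.id ℝ V) R.coeff K k =
      ((taylorAtZero F).comp (formalSeries K)) k (fun _ => 1) -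
        ((formalSeries K).comp (formalSeries R.coeff)) k (fun _ => 1) := by
    intro k
    rw [comp_formalSeries_apply_one, comp_formalSeries_apply_one, invResidual, compCoeff_sub,
      compCoeff_id K hK, compCoeff_formalSeries]
    simp [sub_smul, Finset.sum_sub_distrib, ite_smul]
  simp only [h, sub_eq_zero]
  rw [FormalInvariance]
  constructor
  · intro h k
    rw [h]
  · intro h
    funext k
    exact ContinuousMultilinearMap.ext_ring (by simpa using h k)

end Residual

/-- The sequence `K` with all terms from the `n`-th on replaced by zero. -/
def truncSeq {V : Type*} [Zero V] (n : ℕ) (K : ℕ → V) : ℕ → V :=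
  fun j => if j < n then K j else 0

theorem truncSeq_of_lt {V : Type*} [Zero V] {n j : ℕ} (h : j < n) (K : ℕ → V) :
    truncSeq n K j = K j := if_pos h

theorem truncSeq_of_le {V : Type*} [Zero V] {n j : ℕ} (h : n ≤ j) (K : ℕ → V) :
    truncSeq n K j = 0 := if_neg (not_lt.2 h)

theorem truncSeq_congr {V : Type*} [Zero V] {n : ℕ} {K K' : ℕ → V} (hK : ∀ j < n, K j = K' j) :
    truncSeq n K = truncSeq n K' := by
  funext j
  by_cases hj : j < n
  · rw [truncSeq_of_lt hj, truncSeq_of_lt hj, hK j hj]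
  · rw [truncSeq_of_le (not_lt.1 hj), truncSeq_of_le (not_lt.1 hj)]

/-! ### Coefficients of powers of a series tangent to the identity -/

section PowCoeff

/-- `r` is the coefficient sequence of a series `t - a t^N + ⋯`. -/
structure IsTangentSeries (N : ℕ) (a : ℝ) (r : ℕ → ℝ) : Prop where
  one : r 1 = 1
  gap : ∀ j, 2 ≤ j → j < N → r j = 0
  top : r N = -a

theorem powCoeff_self {r : ℕ → ℝ} (h1 : r 1 = 1) (k : ℕ) : powCoeff r k k = 1 := by
  simp [powCoeff, tuples_self, h1]

theorem powCoeff_one {r : ℕ → ℝ} {k : ℕ} (h : 1 ≤ k) : powCoeff r k 1 = r k := by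
  simp [powCoeff, tuples_one h]

theorem powCoeff_congr {r r' : ℕ → ℝ} {k j : ℕ} (h : ∀ i, i + j ≤ k + 1 → r i = r' i) :
    powCoeff r k j = powCoeff r' k j :=
  Finset.sum_congr rfl fun _ hf => Finset.prod_congr rfl fun i _ =>
    h _ (entry_add_length_le hf i)

variable {N : ℕ} {a : ℝ} {r : ℕ → ℝ}

/-- Since `k > j`, every tuple has an entry other than one; the total excess is too small for it to
reach `N`, so it falls in the gap of `r`. -/
theorem IsTangentSeries.powCoeff_gap (hr : IsTangentSeries N a r) {k j : ℕ} (hjk : j < k)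
    (h : k + 1 < j + N) : powCoeff r k j = 0 := by
  refine Finset.sum_eq_zero fun f hf => ?_
  have h1 : ∃ i, f i ≠ 1 := by
    by_contra! hc
    have := (mem_tuples.1 hf).2
    simp [hc] at this
    omega
  obtain ⟨i, hi⟩ := h1
  have h2 := (mem_tuples.1 hf).1 i
  have h3 := entry_add_length_le hf i
  exact Finset.prod_eq_zero (Finset.mem_univ i) (hr.gap _ (by omega) (by omega))

/-- Only tuples with one entry `N` and ones elsewhere survive the gap; there are `j` positions for
that entry. -/
theorem IsTangentSeries.powCoeff_top (hr : IsTangentSeries N a r) (hN : 2 ≤ N) {j : ℕ}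
    (hj : 1 ≤ j) : powCoeff r (N + j - 1) j = -(a * j) := by
  rw [powCoeff, sum_tuples_top hj hN, Finset.sum_eq_zero, zero_add]
  · have : ∀ i : Fin j, ∏ x, r (Function.update (fun _ => 1) i N x) = -a := by
      intro i
      rw [← Finset.mul_prod_erase _ _ (Finset.mem_univ i), Finset.prod_eq_one]
      · simp [hr.top]
      · intro x hx
        simp [Finset.ne_of_mem_erase hx, hr.one]
    simp [this, mul_comm]
  · intro f hf
    rw [Finset.mem_filter] at hf
    have h1 : ∃ i, f i ≠ 1 := by
      by_contra! hc
      have := (mem_tuples.1 hf.1).2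
      simp [hc] at this
      omega
    obtain ⟨i, hi⟩ := h1
    have h2 := (mem_tuples.1 hf.1).1 i
    exact Finset.prod_eq_zero (Finset.mem_univ i) (hr.gap _ (by omega) (hf.2 i))

end PowCoeff

/-! ### The leading dependence of the residual on `K_n` -/

section Linearization

variable {V W : Type*} [NormedAddCommGroup V] [NormedSpace ℝ V]
  [NormedAddCommGroup W] [NormedSpace ℝ W]

/-- Terms of length `l < m` vanish and those with `l > m` have all entries below `n`. For `l = m`
the entry `n` occurs only together with ones, which gives the linearization of `p m` along `K 1`. -/
theorem compCoeff_top (p : FormalMultilinearSeries ℝ V W) {m n : ℕ} (hm : 1 ≤ m) (hn : 2 ≤ n)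
    (hp : ∀ l < m, p l = 0) (K : ℕ → V) :
    compCoeff p K (n + m - 1) =
      (p m).linearDeriv (fun _ => K 1) (fun _ => K n) + compCoeff p (truncSeq n K) (n + m - 1) := by
  have hmem : m ∈ Finset.range (n + m - 1 + 1) := by simp; omega
  rw [compCoeff, compCoeff, ← Finset.add_sum_erase _ _ hmem, ← Finset.add_sum_erase _ _ hmem,
    ← add_assoc]
  congr 1
  · have hz : ∑ i : Fin m, p m (fun x => truncSeq n K (Function.update (fun _ => 1) i n x)) = 0 :=
      Finset.sum_eq_zero fun i _ => (p m).map_coord_zero i (by simp [truncSeq])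
    rw [sum_tuples_top hm hn, sum_tuples_top hm hn, hz, add_zero, add_comm,
      ContinuousMultilinearMap.linearDeriv_apply]
    · congr 1
      · refine Finset.sum_congr rfl fun i _ => ?_
        congr 1
        funext x
        by_cases h : x = i
        · subst h; simp
        · simp [h]
      · refine Finset.sum_congr rfl fun f hf => ?_
        congr 1
        funext x
        rw [truncSeq_of_lt ((Finset.mem_filter.1 hf).2 x)]
  · refine Finset.sum_congr rfl fun l hl => Finset.sum_congr rfl fun f hf => ?_
    rcases lt_or_gt_of_ne (Finset.ne_of_mem_erase hl) with h | h
    · simp [hp l h]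
    · congr 1
      funext x
      have := entry_add_length_le hf x
      rw [truncSeq_of_lt (by omega)]

variable {N m : ℕ} {a : ℝ} {r : ℕ → ℝ}

/-- Besides the linearization of `p m`, `K n` enters through `K ∘ r - K`. For `m < N` the gap, or
for `m = 1` the subtracted identity, cancels it; for `m = N` the coefficient `-(n a)` of
`powCoeff_top` survives. -/
theorem invResidual_top (p : FormalMultilinearSeries ℝ V W) (π : V →L[ℝ] W) {n : ℕ}
    (hr : IsTangentSeries N a r) (hN : 2 ≤ N)
    (hm : 1 ≤ m) (hmN : m ≤ N) (hn : 2 ≤ n) (hp : ∀ l < m, p l = 0) (K : ℕ → V) :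
    invResidual p π r K (n + m - 1) =
      (p m).linearDeriv (fun _ => K 1) (fun _ => K n) +
        (if m = N then ((n : ℝ) * a) • π (K n) else 0) +
          invResidual p π r (truncSeq n K) (n + m - 1) := by
  have key : ∑ j ∈ Finset.range (n + m - 1 + 1),
        (powCoeff r (n + m - 1) j - if j = n + m - 1 then 1 else 0) • π (K j) =
      ∑ j ∈ Finset.range (n + m - 1 + 1),
        (powCoeff r (n + m - 1) j - if j = n + m - 1 then 1 else 0) • π (truncSeq n K j) -
          (if m = N then ((n : ℝ) * a) • π (K n) else 0) := by
    have hmem : n ∈ Finset.range (n + m - 1 + 1) := by simp; omega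
    rw [← Finset.add_sum_erase _ _ hmem, ← Finset.add_sum_erase _ _ hmem,
      truncSeq_of_le le_rfl, map_zero, smul_zero, zero_add, add_comm (_ • _), sub_eq_add_neg (Finset.sum _ _)]
    refine congrArg₂ (· + ·) ?_ ?_
    · refine Finset.sum_congr rfl fun j hj => ?_
      rcases lt_or_gt_of_ne (Finset.ne_of_mem_erase hj) with h | h
      · rw [truncSeq_of_lt h]
      · have hj' := Finset.mem_range.1 (Finset.mem_of_mem_erase hj)
        rw [truncSeq_of_le h.le, map_zero, smul_zero]
        by_cases hk : j = n + m - 1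
        · rw [hk, powCoeff_self hr.one]; simp
        · rw [hr.powCoeff_gap (by omega) (by omega)]; simp [hk]
    · by_cases h : m = N
      · subst h
        rw [show n + m - 1 = m + n - 1 by omega, hr.powCoeff_top hN (by omega)]
        rw [if_neg (by omega), if_pos rfl, sub_zero, neg_smul, mul_comm]
      · rw [if_neg h, neg_zero]
        by_cases h1 : m = 1
        · subst h1
          simp [powCoeff_self hr.one]
        · rw [hr.powCoeff_gap (by omega) (by omega), if_neg (by omega)]
          simp
  rw [invResidual, invResidual, compCoeff_top p hm hn hp, key]
  abel

theorem invResidual_of_lt (p : FormalMultilinearSeries ℝ V W) (π : V →L[ℝ] W) {k : ℕ}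
    (hr : IsTangentSeries N a r) (hmN : m ≤ N) (hk : k < m) (hp : ∀ l < m, p l = 0) {K : ℕ → V}
    (hK : K 0 = 0) : invResidual p π r K k = 0 := by
  rw [invResidual, compCoeff, Finset.sum_eq_zero, Finset.sum_eq_zero, sub_zero]
  · intro j hj
    have hj' := Finset.mem_range.1 hj
    by_cases h : j = k
    · subst h; simp [powCoeff_self hr.one]
    · rcases Nat.eq_zero_or_pos j with h0 | h0
      · simp [h0, hK]
      · rw [hr.powCoeff_gap (by omega) (by omega)]; simp [h]
  · intro l hl
    have := Finset.mem_range.1 hl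
    simp [hp l (by omega)]

/-- The case `n = 1` of the recursion, which `invResidual_top` excludes: the equation at order `m`
involves `K 1` alone. -/
theorem invResidual_self (p : FormalMultilinearSeries ℝ V W) (π : V →L[ℝ] W)
    (hr : IsTangentSeries N a r) (hN : 2 ≤ N) (hm : 1 ≤ m) (hmN : m ≤ N)
    (hp : ∀ l < m, p l = 0) {K : ℕ → V} (hK : K 0 = 0) :
    invResidual p π r K m =
      p m (fun _ => K 1) + (if m = N then a • π (K 1) else 0) := by
  have hmem : 1 ∈ Finset.range (m + 1) := by simp; omega
  rw [invResidual, compCoeff, Finset.sum_range_succ, Finset.sum_eq_zero, zero_add, tuples_self,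
    Finset.sum_singleton, ← Finset.add_sum_erase _ _ hmem, Finset.sum_eq_zero, add_zero,
    powCoeff_one hm, sub_eq_add_neg]
  · congr 1
    by_cases h : m = N
    · subst h
      simp [hr.top, show ¬ 1 = m by omega]
    · by_cases h1 : m = 1
      · subst h1; simp [h, hr.one]
      · simp [h, hr.gap m (by omega) (by omega), show ¬ 1 = m by omega]
  · intro j hj
    have hj' := Finset.mem_range.1 (Finset.mem_of_mem_erase hj)
    have hj1 := Finset.ne_of_mem_erase hj
    by_cases h : j = m
    · subst h; simp [powCoeff_self hr.one]
    · rcases Nat.eq_zero_or_pos j with h0 | h0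
      · simp [h0, hK]
      · rw [hr.powCoeff_gap (by omega) (by omega)]; simp [h]
  · intro l hl
    have := Finset.mem_range.1 hl
    simp [hp l (by omega)]

theorem invResidual_congr (p : FormalMultilinearSeries ℝ V W) (π : V →L[ℝ] W) {r r' : ℕ → ℝ}
    {k : ℕ} {K : ℕ → V} (hr : ∀ j, powCoeff r k j = powCoeff r' k j ∨ π (K j) = 0) :
    invResidual p π r K k = invResidual p π r' K k := by
  rw [invResidual, invResidual]
  congr 1
  refine Finset.sum_congr rfl fun j _ => ?_
  rcases hr j with h | h <;> simp [h]

/-- Isolates the term `j = 1`, whose power coefficient is `r k` itself. With `k = 2N - 1` it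
exhibits the dependence on `b`. -/
theorem invResidual_add_eq (p : FormalMultilinearSeries ℝ V W) (π : V →L[ℝ] W) {r r' : ℕ → ℝ}
    {k : ℕ} (hk : 1 ≤ k) {K : ℕ → V}
    (hr : ∀ j, j ≠ 1 → powCoeff r k j = powCoeff r' k j ∨ π (K j) = 0) :
    invResidual p π r K k + r k • π (K 1) = invResidual p π r' K k + r' k • π (K 1) := by
  have hmem : 1 ∈ Finset.range (k + 1) := by simp; omega
  have h : ∑ j ∈ (Finset.range (k + 1)).erase 1,
        (powCoeff r k j - if j = k then 1 else 0) • π (K j) =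
      ∑ j ∈ (Finset.range (k + 1)).erase 1,
        (powCoeff r' k j - if j = k then 1 else 0) • π (K j) := by
    refine Finset.sum_congr rfl fun j hj => ?_
    rcases hr j (Finset.ne_of_mem_erase hj) with h | h <;> simp [h]
  rw [invResidual, invResidual, ← Finset.add_sum_erase _ _ hmem, ← Finset.add_sum_erase _ _ hmem, h,
    powCoeff_one hk, powCoeff_one hk, sub_smul, sub_smul]
  abel

end Linearization

/-! ### Taylor coefficients of homogeneous and analytic maps -/

section Taylor

variable {V W : Type*} [NormedAddCommGroup V] [NormedSpace ℝ V]
  [NormedAddCommGroup W] [NormedSpace ℝ W]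

/-- Dilation by `2` multiplies the `l`-th derivative at `0` by `2^l`, homogeneity by `2^m`. -/
theorem iteratedFDeriv_eq_zero_of_homogeneous {P : V → W} {m l : ℕ} (hP : ContDiff ℝ ⊤ P)
    (hom : ∀ (s : ℝ) (v : V), P (s • v) = s ^ m • P v) (hlm : l ≠ m) :
    iteratedFDeriv ℝ l P 0 = 0 := by
  have hl : ContDiff ℝ l P := hP.of_le (by exact_mod_cast le_top)
  have h1 := congrFun (iteratedFDeriv_comp_const_smul (2 : ℝ) hl) 0
  have h2 : (fun z => P ((2 : ℝ) • z)) = (2 : ℝ) ^ m • P := by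
    funext z
    exact hom 2 z
  rw [h2, iteratedFDeriv_const_smul_apply hl.contDiffAt, smul_zero] at h1
  have h3 : ((2 : ℝ) ^ m - 2 ^ l) • iteratedFDeriv ℝ l P 0 = 0 := by
    rw [sub_smul, h1, sub_self]
  refine (smul_eq_zero.1 h3).resolve_left fun h => hlm ?_
  have h4 : (2 : ℝ) ^ m = 2 ^ l := sub_eq_zero.1 h
  exact (pow_right_injective₀ (by norm_num) (by norm_num) h4).symm

/-- Smoothness `⊤` is analyticity, so near `0` the Taylor series sums to `P`, and only its `m`-th
term is nonzero. Homogeneity carries the identity from a small `s • v`, `s ≠ 0`, to `v`. -/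
theorem taylorAtZero_diag_of_homogeneous [CompleteSpace W] {P : V → W} {m : ℕ}
    (hP : ContDiff ℝ ⊤ P) (hom : ∀ (s : ℝ) (v : V), P (s • v) = s ^ m • P v) (v : V) :
    taylorAtZero P m (fun _ => v) = P v := by
  have small : ∃ s : ℝ, s ≠ 0 ∧ taylorAtZero P m (fun _ => s • v) = P (s • v) := by
    obtain ⟨p, ρ, hp⟩ := hP.contDiffAt.analyticAt (x := 0)
    have h1 : ∀ᶠ s : ℝ in nhds 0, s • v ∈ Metric.eball (0 : V) ρ := by
      have : Filter.Tendsto (fun s : ℝ => s • v) (nhds 0) (nhds ((0 : ℝ) • v)) :=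
        (continuous_id.smul continuous_const).tendsto 0
      rw [zero_smul] at this
      exact this.eventually (Metric.eball_mem_nhds 0 hp.r_pos)
    obtain ⟨s, hs, hs0⟩ := ((h1.filter_mono nhdsWithin_le_nhds).and
      (self_mem_nhdsWithin (a := (0 : ℝ)) (s := {0}ᶜ))).exists
    refine ⟨s, hs0, ?_⟩
    have h2 := hp.hasSum_iteratedFDeriv hs
    rw [zero_add] at h2
    refine HasSum.unique (hasSum_single m ?_) h2
    intro l hl
    rw [iteratedFDeriv_eq_zero_of_homogeneous hP hom hl]
    simp
  obtain ⟨s, hs, h⟩ := small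
  have h3 := (taylorAtZero P m).map_smul_univ (fun _ => s) (fun _ => v)
  rw [h, hom] at h3
  simp only [Finset.prod_const, Finset.card_univ, Fintype.card_fin] at h3
  exact (smul_right_injective W (pow_ne_zero m hs) h3).symm

/-- `D^n F(0) / n!` is the average over permutations of the arguments of any power series of `F`, so
it inherits the geometric bound of that series. -/
theorem exists_norm_taylorAtZero_le [CompleteSpace W] {F : V → W} (hF : AnalyticAt ℝ F 0) :
    ∃ A > 0, ∃ β > 0, ∀ n, ‖taylorAtZero F n‖ ≤ A * β ^ n := by
  obtain ⟨p, ρ, hp⟩ := hF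
  obtain ⟨A, β, hA, hβ, h⟩ := p.le_mul_pow_of_radius_pos (hp.r_pos.trans_le hp.r_le)
  refine ⟨A, hA, β, hβ, fun n => ?_⟩
  refine ContinuousMultilinearMap.opNorm_le_bound (by positivity) fun v => ?_
  have h1 : taylorAtZero F n v = (n ! : ℝ)⁻¹ • ∑ σ : Equiv.Perm (Fin n), p n (fun i => v (σ i)) := by
    rw [← hp.iteratedFDeriv_eq_sum_of_completeSpace]
    rfl
  have h2 : ∀ σ : Equiv.Perm (Fin n), ‖p n (fun i => v (σ i))‖ ≤ A * β ^ n * ∏ i, ‖v i‖ := by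
    intro σ
    refine ((p n).le_opNorm _).trans ?_
    rw [Equiv.prod_comp σ (fun i => ‖v i‖)]
    gcongr
    exact h n
  rw [h1, norm_smul, norm_inv, Real.norm_natCast]
  calc (n ! : ℝ)⁻¹ * ‖∑ σ : Equiv.Perm (Fin n), p n (fun i => v (σ i))‖
      ≤ (n ! : ℝ)⁻¹ * ∑ _σ : Equiv.Perm (Fin n), A * β ^ n * ∏ i, ‖v i‖ := by
        gcongr
        exact norm_sum_le_of_le _ fun σ _ => h2 σ
    _ = A * β ^ n * ∏ i, ‖v i‖ := by
        rw [Finset.sum_const, Finset.card_univ, Fintype.card_perm, Fintype.card_fin, nsmul_eq_mul,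
          ← mul_assoc, inv_mul_cancel₀ (by positivity), one_mul]

theorem taylorAtZero_id [CompleteSpace V] :
    taylorAtZero (fun v : V => v) = FormalMultilinearSeries.id ℝ V 0 := by
  have hom : ∀ (s : ℝ) (v : V), (fun v : V => v) (s • v) = s ^ 1 • (fun v : V => v) v := by simp
  have h0 : ∀ l, l ≠ 1 → taylorAtZero (fun v : V => v) l = 0 := by
    intro l hl
    have h := iteratedFDeriv_eq_zero_of_homogeneous (P := fun v : V => v) contDiff_id hom hl
    rw [taylorAtZero, h, smul_zero]
  funext l
  rcases lt_trichotomy l 1 with h | h | h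
  · obtain rfl : l = 0 := by omega
    rw [h0 0 (by norm_num)]
    ext v
    simp
  · subst h
    ext v
    have : v = fun _ => v 0 := by funext i; rw [Subsingleton.elim i 0]
    rw [FormalMultilinearSeries.id_apply_one, this]
    exact taylorAtZero_diag_of_homogeneous contDiff_id hom (v 0)
  · rw [h0 l (by omega), FormalMultilinearSeries.id_apply_of_one_lt ℝ V 0 h]

/-- The deviation of the Taylor series of `F` from that of the identity, in the component `π`,
when that component of `F - id` is a homogeneous function plus terms of higher order. -/
theorem taylor_component [CompleteSpace V] [CompleteSpace W] {F : V → V} (hF : AnalyticAt ℝ F 0)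
    (π : V →L[ℝ] W) {P f : V → W} {m : ℕ} (hP : ContDiff ℝ ⊤ P)
    (hom : ∀ (s : ℝ) (v : V), P (s • v) = s ^ m • P v) (hf : HasOrderAtZero (m + 1) f)
    (h : ∀ᶠ v in nhds 0, π (F v) = π v + P v + f v) :
    (∀ l < m, π.compFormalMultilinearSeries
      (taylorAtZero F - FormalMultilinearSeries.id ℝ V 0) l = 0) ∧
    ∀ v, π.compFormalMultilinearSeries
      (taylorAtZero F - FormalMultilinearSeries.id ℝ V 0) m (fun _ => v) = P v := by
  have hF' : ∀ l : ℕ, ContDiffAt ℝ l F 0 := fun l => hF.contDiffAt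
  have hP2 : ∀ l : ℕ, ContDiffAt ℝ l P 0 := fun l =>
    (hP.of_le (by exact_mod_cast le_top)).contDiffAt
  have hfe : f =ᶠ[nhds 0] fun v => π (F v - v) - P v := by
    filter_upwards [h] with v hv
    rw [map_sub, hv]
    abel
  have hGc : ∀ l : ℕ, ContDiffAt ℝ l (fun v => F v - v) 0 := fun l => (hF' l).sub contDiffAt_id
  have hπGc : ∀ l : ℕ, ContDiffAt ℝ l (fun v => π (F v - v)) 0 := fun l =>
    π.contDiff.contDiffAt.comp 0 (hGc l)
  have key : ∀ l ≤ m, π.compFormalMultilinearSeries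
      (taylorAtZero F - FormalMultilinearSeries.id ℝ V 0) l = taylorAtZero P l := by
    intro l hl
    have e1 : (taylorAtZero F - FormalMultilinearSeries.id ℝ V 0) l =
        (l ! : ℝ)⁻¹ • iteratedFDeriv ℝ l (fun v => F v - v) 0 := by
      have e0 := fun_iteratedFDeriv_sub_apply (g := fun v : V => v) (hF' l) contDiffAt_id
      rw [← taylorAtZero_id, e0, smul_sub]
      rfl
    have e2 : iteratedFDeriv ℝ l (fun v => π (F v - v)) 0 =
        π.compContinuousMultilinearMap (iteratedFDeriv ℝ l (fun v => F v - v) 0) :=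
      π.iteratedFDeriv_comp_left (hGc l) le_rfl
    have e3 : iteratedFDeriv ℝ l (fun v => π (F v - v)) 0 = iteratedFDeriv ℝ l P 0 := by
      have h1 := hf l (by omega)
      rw [(hfe.iteratedFDeriv ℝ l).eq_of_nhds,
        fun_iteratedFDeriv_sub_apply (hπGc l) (hP2 l)] at h1
      exact sub_eq_zero.1 h1
    ext v
    rw [ContinuousLinearMap.compFormalMultilinearSeries_apply, e1]
    have e4 := congrArg (fun M => (l ! : ℝ)⁻¹ • M v) (e2.symm.trans e3)
    simpa [taylorAtZero] using e4
  refine ⟨fun l hl => ?_, fun v => ?_⟩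
  · rw [key l hl.le, taylorAtZero, iteratedFDeriv_eq_zero_of_homogeneous hP hom hl.ne, smul_zero]
  · rw [key m le_rfl, taylorAtZero_diag_of_homogeneous hP hom]

/-- The linearization along the diagonal depends only on the diagonal values of `p`, so it can be
computed by differentiating the homogeneous map along a line. -/
theorem linearDeriv_eq_of_hasDerivAt {m : ℕ} (p : ContinuousMultilinearMap ℝ (fun _ : Fin m => V) W)
    {P : V → W} (hp : ∀ v, p (fun _ => v) = P v) (e v : V) {D : W}
    (h : HasDerivAt (fun s : ℝ => P (e + s • v)) D 0) :
    p.linearDeriv (fun _ => e) (fun _ => v) = D := by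
  have h1 : HasDerivAt (fun s : ℝ => (fun _ : Fin m => e + s • v)) (fun _ => v) 0 := by
    rw [hasDerivAt_pi]
    intro _
    simpa using ((hasDerivAt_id (0 : ℝ)).smul_const v).const_add e
  have h2 := (p.hasFDerivAt (fun _ : Fin m => e + (0 : ℝ) • v)).comp_hasDerivAt (0 : ℝ) h1
  simp only [Function.comp_def, hp, zero_smul, add_zero] at h2
  exact h2.unique h

/-- Euler's identity. -/
theorem linearDeriv_self {m : ℕ} (p : ContinuousMultilinearMap ℝ (fun _ : Fin m => V) W) (e : V) :
    p.linearDeriv (fun _ => e) (fun _ => e) = (m : ℝ) • p (fun _ => e) := by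
  rw [ContinuousMultilinearMap.linearDeriv_apply]
  have : ∀ i : Fin m, Function.update (fun _ => e) i e = fun _ => e := fun i =>
    Function.update_eq_self i _
  simp [← Nat.cast_smul_eq_nsmul ℝ]

end Taylor

/-! ### Evaluation of polynomials on phase space -/

section Polynomials

open MvPolynomial

theorem MvPolynomial.IsHomogeneous.eval_smul {σ : Type*} {ψ : MvPolynomial σ ℝ} {m : ℕ}
    (hψ : ψ.IsHomogeneous m) (s : ℝ) (c : σ → ℝ) : eval (s • c) ψ = s ^ m * eval c ψ := by
  rw [eval_eq, eval_eq, Finset.mul_sum]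
  refine Finset.sum_congr rfl fun δ hδ => ?_
  have h := hψ (mem_support_iff.1 hδ)
  have h' : δ.degree = m := (Finsupp.degree_eq_weight_one (R := ℕ) (σ := σ) ▸ h :)
  rw [Finsupp.degree_apply] at h'
  simp only [Pi.smul_apply, smul_eq_mul, mul_pow, Finset.prod_mul_distrib]
  rw [Finset.prod_pow_eq_pow_sum, h']
  ring

theorem MvPolynomial.hasDerivAt_eval {σ : Type*} [Fintype σ] (ψ : MvPolynomial σ ℝ)
    {c : ℝ → σ → ℝ} {c' : σ → ℝ} {t : ℝ} (hc : ∀ i, HasDerivAt (fun s => c s i) (c' i) t) :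
    HasDerivAt (fun s => eval (c s) ψ) (∑ i, eval (c t) (pderiv i ψ) * c' i) t := by
  classical
  induction ψ using MvPolynomial.induction_on with
  | C r => simpa using hasDerivAt_const t r
  | add p q hp hq =>
    simp only [map_add, add_mul, Finset.sum_add_distrib]
    exact hp.add hq
  | mul_X p i hp =>
    simp only [map_mul, eval_X]
    convert! hp.mul (hc i) using 1
    simp only [Derivation.leibniz, pderiv_X, smul_eq_mul, map_add, map_mul, eval_X, add_mul,
      Finset.sum_add_distrib, Finset.sum_mul]
    rw [add_comm]
    congr 1
    · exact Finset.sum_congr rfl fun j _ => by ring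
    · rw [Finset.sum_eq_single i]
      · simp
      · intro j _ hj
        simp [hj.symm]
      · simp

theorem Phase.coords_smul {d d' : ℕ} (s : ℝ) (v : Phase d d') : (s • v).coords = s • v.coords := by
  funext i
  rcases i with i | i | i <;> simp [Phase.coords]

theorem Phase.contDiff_eval {d d' : ℕ} (ψ : MvPolynomial (Coord d d') ℝ) :
    ContDiff ℝ ⊤ fun v : Phase d d' => eval v.coords ψ := by
  induction ψ using MvPolynomial.induction_on with
  | C r => simpa using contDiff_const
  | add p q hp hq => simpa using hp.add hq
  | mul_X p i hp =>
    simp only [map_mul, eval_X]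
    refine hp.mul ?_
    rcases i with i | i | i <;> simp only [Phase.coords, Sum.elim_inl, Sum.elim_inr] <;> fun_prop

end Polynomials

/-! ### Components of phase space and the jet of the system -/

namespace Phase

variable {d d' : ℕ}

/-- The `x`-component. -/
def projX : Phase d d' →L[ℝ] ℝ := ContinuousLinearMap.fst ℝ _ _

/-- The `y`-component. -/
def projY : Phase d d' →L[ℝ] (Fin d → ℝ) :=
  (ContinuousLinearMap.fst ℝ _ _).comp (ContinuousLinearMap.snd ℝ _ _)

/-- The `z`-component. -/
def projZ : Phase d d' →L[ℝ] (Fin d' → ℝ) :=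
  (ContinuousLinearMap.snd ℝ _ _).comp (ContinuousLinearMap.snd ℝ _ _)

@[simp] theorem projX_apply (v : Phase d d') : projX v = v.1 := rfl
@[simp] theorem projY_apply (v : Phase d d') : projY v = v.2.1 := rfl
@[simp] theorem projZ_apply (v : Phase d d') : projZ v = v.2.2 := rfl

/-- The first coordinate vector `(1, 0, 0)`. -/
def unitX : Phase d d' := (1, 0, 0)

theorem const_eq_smul_unitX_add {m : ℕ} (v : Phase d d') :
    (fun _ : Fin m => v) = v.1 • (fun _ : Fin m => (unitX : Phase d d')) +
      fun _ : Fin m => ((0, v.2.1, v.2.2) : Phase d d') := by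
  funext _
  ext <;> simp [unitX]

end Phase

open Phase

/-- The properties of the Taylor coefficients `q` of `F - id` that determine the formal solutions;
`ℓ` is the linearization of the degree `N` part of the `x`-component in the directions `y, z`. -/
structure IsSystemJet {d d' : ℕ} (N M : ℕ) (a : ℝ) (B₁ : Matrix (Fin d) (Fin d) ℝ)
    (B₂ : Matrix (Fin d) (Fin d') ℝ) (C : Matrix (Fin d') (Fin d') ℝ)
    (ℓ : ((Fin d → ℝ) × (Fin d' → ℝ)) →L[ℝ] ℝ)
    (q : FormalMultilinearSeries ℝ (Phase d d') (Phase d d')) : Prop where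
  two_le : 2 ≤ M
  le : M ≤ N
  order_x : ∀ l < N, projX.compFormalMultilinearSeries q l = 0
  order_y : ∀ l < M, projY.compFormalMultilinearSeries q l = 0
  order_z : ∀ l < 1, projZ.compFormalMultilinearSeries q l = 0
  diag_x : projX.compFormalMultilinearSeries q N (fun _ => unitX) = -a
  diag_y : projY.compFormalMultilinearSeries q M (fun _ => unitX) = 0
  diag_z : projZ.compFormalMultilinearSeries q 1 (fun _ => unitX) = 0
  lin_x : ∀ v, (projX.compFormalMultilinearSeries q N).linearDeriv (fun _ => unitX) (fun _ => v) =
    -(a * N) * v.1 + ℓ v.2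
  lin_y : ∀ v, (projY.compFormalMultilinearSeries q M).linearDeriv (fun _ => unitX) (fun _ => v) =
    B₁.mulVec v.2.1 + B₂.mulVec v.2.2
  lin_z : ∀ v, (projZ.compFormalMultilinearSeries q 1).linearDeriv (fun _ => unitX) (fun _ => v) =
    (C - 1).mulVec v.2.2
  bound : ∃ A > 0, ∃ β > 0, ∀ n, ‖q n‖ ≤ A * β ^ n

theorem Phase.contDiff_mulVec_y {d d' : ℕ} {ι : Type*} [Fintype ι] (B : Matrix ι (Fin d) ℝ) :
    ContDiff ℝ ⊤ fun v : Phase d d' => B.mulVec v.2.1 := by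
  have : ContDiff ℝ ⊤ fun y : Fin d → ℝ => B.mulVec y :=
    (Matrix.mulVecLin B).toContinuousLinearMap.contDiff
  fun_prop

theorem Phase.contDiff_mulVec_z {d d' : ℕ} {ι : Type*} [Fintype ι] (B : Matrix ι (Fin d') ℝ) :
    ContDiff ℝ ⊤ fun v : Phase d d' => B.mulVec v.2.2 := by
  have : ContDiff ℝ ⊤ fun y : Fin d' → ℝ => B.mulVec y :=
    (Matrix.mulVecLin B).toContinuousLinearMap.contDiff
  fun_prop

section

variable {d d' : ℕ} {N M : ℕ} {a : ℝ} {F : Phase d d' → Phase d d'}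

/-- The Taylor coefficients of `F - id`. -/
def deviationSeries {V : Type*} [NormedAddCommGroup V] [NormedSpace ℝ V] (F : V → V) :
    FormalMultilinearSeries ℝ V V :=
  taylorAtZero F - FormalMultilinearSeries.id ℝ V 0

theorem deviation_x (hF : AnalyticAt ℝ F 0) {fN : MvPolynomial (Coord d d') ℝ}
    {f : Phase d d' → ℝ} (hfN : fN.IsHomogeneous N)
    (hfN0 : ∀ x : ℝ, MvPolynomial.eval (Phase.coords ((x, 0, 0) : Phase d d')) fN = 0)
    (hf : HasOrderAtZero (N + 1) f)
    (h : ∀ᶠ v in nhds 0, (F v).1 = v.1 - a * v.1 ^ N + MvPolynomial.eval v.coords fN + f v) :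
    (∀ l < N, projX.compFormalMultilinearSeries (deviationSeries F) l = 0) ∧
    projX.compFormalMultilinearSeries (deviationSeries F) N (fun _ => unitX) = -a := by
  have hP : ContDiff ℝ ⊤ fun v : Phase d d' => -a * v.1 ^ N + MvPolynomial.eval v.coords fN :=
    (contDiff_const.mul (contDiff_fst.pow N)).add (contDiff_eval fN)
  have key := taylor_component hF projX (m := N) hP ?_ hf ?_
  · refine ⟨key.1, (key.2 unitX).trans ?_⟩
    have := hfN0 1
    simp [unitX, this]
  · intro s v
    rw [Phase.coords_smul, hfN.eval_smul]
    simp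
    ring
  · filter_upwards [h] with v hv
    simp [hv]
    ring

theorem deviation_y (hF : AnalyticAt ℝ F 0) (hM : 2 ≤ M) {B₁ : Matrix (Fin d) (Fin d) ℝ}
    {B₂ : Matrix (Fin d) (Fin d') ℝ} {gM : Fin d → MvPolynomial (Coord d d') ℝ}
    {g : Phase d d' → Fin d → ℝ} (hgM : ∀ i, (gM i).IsHomogeneous M)
    (hgM0 : ∀ i, ∀ x : ℝ, MvPolynomial.eval (Phase.coords ((x, 0, 0) : Phase d d')) (gM i) = 0)
    (hgMy : ∀ i, ∀ j : Fin d, ∀ x : ℝ, MvPolynomial.eval (Phase.coords ((x, 0, 0) : Phase d d'))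
        (MvPolynomial.pderiv (Sum.inr (Sum.inl j)) (gM i)) = 0)
    (hgMz : ∀ i, ∀ j : Fin d', ∀ x : ℝ, MvPolynomial.eval (Phase.coords ((x, 0, 0) : Phase d d'))
        (MvPolynomial.pderiv (Sum.inr (Sum.inr j)) (gM i)) = 0)
    (hg : HasOrderAtZero (M + 1) g)
    (h : ∀ᶠ v in nhds 0, (F v).2.1 = v.2.1 + v.1 ^ (M - 1) • B₁.mulVec v.2.1 +
      v.1 ^ (M - 1) • B₂.mulVec v.2.2 + (fun i => MvPolynomial.eval v.coords (gM i)) + g v) :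
    (∀ l < M, projY.compFormalMultilinearSeries (deviationSeries F) l = 0) ∧
    projY.compFormalMultilinearSeries (deviationSeries F) M (fun _ => unitX) = 0 ∧
    ∀ v, (projY.compFormalMultilinearSeries (deviationSeries F) M).linearDeriv
      (fun _ => unitX) (fun _ => v) = B₁.mulVec v.2.1 + B₂.mulVec v.2.2 := by
  have hP : ContDiff ℝ ⊤ fun v : Phase d d' => v.1 ^ (M - 1) • B₁.mulVec v.2.1 +
      v.1 ^ (M - 1) • B₂.mulVec v.2.2 + fun i => MvPolynomial.eval v.coords (gM i) :=
    (((contDiff_fst.pow _).smul (contDiff_mulVec_y B₁)).add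
      ((contDiff_fst.pow _).smul (contDiff_mulVec_z B₂))).add
        (contDiff_pi.2 fun i => contDiff_eval (gM i))
  have key := taylor_component hF projY (m := M) hP ?_ hg ?_
  · have hdiag : projY.compFormalMultilinearSeries (deviationSeries F) M (fun _ => unitX) = 0 := by
      refine (key.2 unitX).trans ?_
      have := fun i => hgM0 i 1
      simp only [unitX, this]
      funext i
      simp
    refine ⟨key.1, hdiag, fun v => ?_⟩
    -- By Euler's identity the x-direction contributes a multiple of the diagonal value, which is
    -- zero. Along the remaining line `x = 1` is constant and the partial derivatives of `gM` in `y`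
    -- and `z` vanish.
    rw [const_eq_smul_unitX_add v, map_add, map_smul, linearDeriv_self, hdiag, smul_zero, smul_zero, zero_add]
    refine linearDeriv_eq_of_hasDerivAt _ key.2 _ _ ?_
    have hc : ∀ i : Coord d d', HasDerivAt
        (fun s : ℝ => (unitX + s • ((0, v.2.1, v.2.2) : Phase d d')).coords i)
        (Phase.coords ((0, v.2.1, v.2.2) : Phase d d') i) 0 := by
      rintro (i | i | i)
      · simpa [Phase.coords, unitX] using hasDerivAt_const (0 : ℝ) (1 : ℝ)
      · simpa [Phase.coords, unitX] using (hasDerivAt_id (0 : ℝ)).mul_const (v.2.1 i)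
      · simpa [Phase.coords, unitX] using (hasDerivAt_id (0 : ℝ)).mul_const (v.2.2 i)
    have hg0 : HasDerivAt (fun (s : ℝ) i =>
        MvPolynomial.eval (unitX + s • ((0, v.2.1, v.2.2) : Phase d d')).coords (gM i)) 0 0 := by
      rw [hasDerivAt_pi]
      intro i
      refine (MvPolynomial.hasDerivAt_eval (gM i) hc).congr_deriv ?_
      rw [Pi.zero_apply]
      refine Finset.sum_eq_zero fun j _ => ?_
      rw [zero_smul, add_zero]
      rcases j with j | j | j
      · simp [Phase.coords]
      · exact mul_eq_zero_of_left (hgMy i j 1) _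
      · exact mul_eq_zero_of_left (hgMz i j 1) _
    have hB : HasDerivAt (fun s : ℝ => s • (B₁.mulVec v.2.1 + B₂.mulVec v.2.2))
        (B₁.mulVec v.2.1 + B₂.mulVec v.2.2) 0 := by
      simpa using (hasDerivAt_id (0 : ℝ)).smul_const (B₁.mulVec v.2.1 + B₂.mulVec v.2.2)
    have := hB.add hg0
    rw [add_zero] at this
    refine this.congr_of_eventuallyEq (Filter.Eventually.of_forall fun s => ?_)
    simp [unitX, Matrix.mulVec_smul]
  · intro s v
    simp only [Phase.coords_smul, (hgM _).eval_smul]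
    obtain ⟨k, rfl⟩ : ∃ k, M = k + 1 := ⟨M - 1, by omega⟩
    funext i
    simp [Matrix.mulVec_smul]
    ring
  · filter_upwards [h] with v hv
    simp only [projY_apply, hv]
    abel

theorem deviation_z (hF : AnalyticAt ℝ F 0) {C : Matrix (Fin d') (Fin d') ℝ}
    {h : Phase d d' → Fin d' → ℝ} (hh : HasOrderAtZero 2 h)
    (hFz : ∀ᶠ v in nhds 0, (F v).2.2 = C.mulVec v.2.2 + h v) :
    (∀ l < 1, projZ.compFormalMultilinearSeries (deviationSeries F) l = 0) ∧
    projZ.compFormalMultilinearSeries (deviationSeries F) 1 (fun _ => unitX) = 0 ∧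
    ∀ v, (projZ.compFormalMultilinearSeries (deviationSeries F) 1).linearDeriv
      (fun _ => unitX) (fun _ => v) = (C - 1).mulVec v.2.2 := by
  have key := taylor_component hF projZ (m := 1) (contDiff_mulVec_z (d := d) (C - 1)) ?_ hh ?_
  · refine ⟨key.1, (key.2 unitX).trans (by simp [unitX]), fun v => ?_⟩
    refine linearDeriv_eq_of_hasDerivAt _ key.2 _ _ ?_
    have : HasDerivAt (fun s : ℝ => s • (C - 1).mulVec v.2.2) ((C - 1).mulVec v.2.2) 0 := by
      simpa using (hasDerivAt_id (0 : ℝ)).smul_const ((C - 1).mulVec v.2.2)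
    refine this.congr_of_eventuallyEq (Filter.Eventually.of_forall fun s => ?_)
    simp [unitX, Matrix.mulVec_smul]
  · intro s v
    simp [Matrix.mulVec_smul]
  · filter_upwards [hFz] with v hv
    simp [hv, Matrix.sub_mulVec]

/-- If `M > N`, the y-component of `F - id` has no terms up to order `N`. It is then treated as a
component of order `N` with zero matrices; its linear part `n a Id` is invertible, and the Gevrey
exponent is unchanged. -/
theorem exists_isSystemJet (hN : 2 ≤ N) (hM : 2 ≤ M) (ha : a ≠ 0)
    {B₁ : Matrix (Fin d) (Fin d) ℝ} {B₂ : Matrix (Fin d) (Fin d') ℝ}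
    {C : Matrix (Fin d') (Fin d') ℝ} {U : Set (Phase d d')} (hF : HasSystemForm N M a B₁ B₂ C U F)
    (hlt : M < N → IsUnit B₁)
    (heq : M = N → ∀ l : ℕ, 2 ≤ l →
      IsUnit (B₁ + ((l : ℝ) * a) • (1 : Matrix (Fin d) (Fin d) ℝ))) :
    ∃ (M' : ℕ) (B₁' : Matrix (Fin d) (Fin d) ℝ) (B₂' : Matrix (Fin d) (Fin d') ℝ)
      (ℓ : ((Fin d → ℝ) × (Fin d' → ℝ)) →L[ℝ] ℝ),
      IsSystemJet N M' a B₁' B₂' C ℓ (deviationSeries F) ∧ (M' < N → IsUnit B₁') ∧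
      (M' = N → ∀ l : ℕ, 2 ≤ l →
        IsUnit (B₁' + ((l : ℝ) * a) • (1 : Matrix (Fin d) (Fin d) ℝ))) ∧
      gevreyExponent N M = gevreyExponent N M' := by
  obtain ⟨fN, gM, f, g, h, hfN, hfN0, hgM, hgM0, hgMy, hgMz, hf, hg, hh, hexp⟩ := hF.expansion
  have hF0 : AnalyticAt ℝ F 0 := hF.analytic 0 hF.zero_mem
  have hU : ∀ᶠ v in nhds (0 : Phase d d'), v ∈ U := hF.isOpen.mem_nhds hF.zero_mem
  have hx := deviation_x hF0 hfN hfN0 hf (a := a) (by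
    filter_upwards [hU] with v hv
    rw [hexp v.1 v.2.1 v.2.2 hv])
  have hy := deviation_y hF0 hM (B₁ := B₁) (B₂ := B₂) hgM hgM0 hgMy hgMz hg (by
    filter_upwards [hU] with v hv
    rw [hexp v.1 v.2.1 v.2.2 hv])
  have hz := deviation_z hF0 (C := C) hh (by
    filter_upwards [hU] with v hv
    rw [hexp v.1 v.2.1 v.2.2 hv])
  let ℓ : ((Fin d → ℝ) × (Fin d' → ℝ)) →L[ℝ] ℝ :=
    ((projX.compFormalMultilinearSeries (deviationSeries F) N).linearDeriv fun _ => unitX).comp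
      (ContinuousLinearMap.pi fun _ => ContinuousLinearMap.inr ℝ ℝ _)
  have hlx : ∀ v, (projX.compFormalMultilinearSeries (deviationSeries F) N).linearDeriv
      (fun _ => unitX) (fun _ => v) = -(a * N) * v.1 + ℓ v.2 := by
    intro v
    rw [const_eq_smul_unitX_add v, map_add, map_smul, linearDeriv_self, hx.2]
    congr 1
    simp only [smul_eq_mul]
    ring
  have hb : ∃ A > 0, ∃ β > 0, ∀ n, ‖deviationSeries F n‖ ≤ A * β ^ n := by
    have h1 : deviationSeries F = taylorAtZero fun v => F v - v := by
      funext l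
      have e0 := fun_iteratedFDeriv_sub_apply (i := l) (g := fun v : Phase d d' => v)
        (hF0.contDiffAt) contDiffAt_id
      rw [deviationSeries, ← taylorAtZero_id]
      change taylorAtZero F l - taylorAtZero (fun v => v) l = _
      rw [taylorAtZero, taylorAtZero, taylorAtZero, e0, smul_sub]
    rw [h1]
    exact exists_norm_taylorAtZero_le (hF0.sub analyticAt_id)
  rcases le_or_gt M N with hMN | hMN
  · exact ⟨M, B₁, B₂, ℓ, ⟨hM, hMN, hx.1, hy.1, hz.1, hx.2, hy.2.1, hz.2.1, hlx, hy.2.2, hz.2.2, hb⟩,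
      hlt, heq, rfl⟩
  · have hyN : projY.compFormalMultilinearSeries (deviationSeries F) N = 0 := hy.1 N hMN
    refine ⟨N, 0, 0, ℓ, ⟨hN, le_rfl, hx.1, fun l hl => hy.1 l (hl.trans hMN), hz.1, hx.2, ?_,
      hz.2.1, hlx, ?_, hz.2.2, hb⟩, fun h => absurd h (lt_irrefl _), fun _ l hl => ?_, ?_⟩
    · rw [hyN]; rfl
    · intro v
      rw [hyN, ContinuousMultilinearMap.linearDeriv_apply]
      simp
    · rw [zero_add, ← Algebra.algebraMap_eq_smul_one]
      refine (IsUnit.mk0 _ (mul_ne_zero ?_ ha)).map (algebraMap ℝ _)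
      exact_mod_cast (by omega : l ≠ 0)
    · simp [gevreyExponent, hMN.le]

end

/-! ### The recursion for formal solutions and its resonance -/

theorem exists_truncSeq_recursion {V : Type*} [Zero V] (S : ℕ → (ℕ → V) → V) :
    ∃ K : ℕ → V, ∀ n, K n = S n (truncSeq n K) := by
  let K : ℕ → V := fun n => Nat.strongRec (motive := fun _ => V)
    (fun n IH => S n fun j => if h : j < n then IH j h else 0) n
  refine ⟨K, fun n => ?_⟩
  have h : K n = S n fun j => if h : j < n then K j else 0 := by
    simp only [K]
    rw [Nat.strongRec]
  rw [h]
  rfl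

theorem truncSeq_recursion_unique {V : Type*} [Zero V] {S : ℕ → (ℕ → V) → V} {K K' : ℕ → V}
    (hK : ∀ n, K n = S n (truncSeq n K)) (hK' : ∀ n, K' n = S n (truncSeq n K')) : K = K' := by
  funext n
  induction n using Nat.strong_induction_on with
  | _ n ih =>
    rw [hK, hK', truncSeq_congr ih]

/-- The polynomial `t - a t^N + b t^(2N-1)`. -/
def reparam (N : ℕ) (a b : ℝ) : Polynomial ℝ :=
  Polynomial.X - Polynomial.C a * Polynomial.X ^ N + Polynomial.C b * Polynomial.X ^ (2 * N - 1)

theorem coeff_reparam (N : ℕ) (a b : ℝ) (k : ℕ) : (reparam N a b).coeff k =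
    (if k = 1 then 1 else 0) - (if k = N then a else 0) + (if k = 2 * N - 1 then b else 0) := by
  simp [reparam, Polynomial.coeff_X, Polynomial.coeff_X_pow, eq_comm]

theorem isTangentSeries_reparam {N : ℕ} (hN : 2 ≤ N) (a b : ℝ) :
    IsTangentSeries N a (reparam N a b).coeff where
  one := by
    rw [coeff_reparam, if_pos rfl, if_neg (by omega), if_neg (by omega)]
    ring
  gap j h1 h2 := by
    rw [coeff_reparam, if_neg (by omega), if_neg (by omega), if_neg (by omega)]
    ring
  top := by
    rw [coeff_reparam, if_neg (by omega), if_pos rfl, if_neg (by omega)]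
    ring

section

variable {d d' : ℕ} {N M : ℕ} {a : ℝ} {B₁ : Matrix (Fin d) (Fin d) ℝ}
  {B₂ : Matrix (Fin d) (Fin d') ℝ} {C : Matrix (Fin d') (Fin d') ℝ}
  {ℓ : ((Fin d → ℝ) × (Fin d' → ℝ)) →L[ℝ] ℝ}
  {q : FormalMultilinearSeries ℝ (Phase d d') (Phase d d')}

/-- The matrix acting on the `y`-component of the `n`-th coefficient. -/
def linY (N M : ℕ) (a : ℝ) (B₁ : Matrix (Fin d) (Fin d) ℝ) (n : ℕ) : Matrix (Fin d) (Fin d) ℝ :=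
  B₁ + if M = N then ((n : ℝ) * a) • 1 else 0

/-- The residual in the `x`-component. -/
def resX (q : FormalMultilinearSeries ℝ (Phase d d') (Phase d d')) (r : ℕ → ℝ)
    (K : ℕ → Phase d d') (k : ℕ) : ℝ :=
  invResidual (projX.compFormalMultilinearSeries q) projX r K k

/-- The residual in the `y`-component. -/
def resY (q : FormalMultilinearSeries ℝ (Phase d d') (Phase d d')) (r : ℕ → ℝ)
    (K : ℕ → Phase d d') (k : ℕ) : Fin d → ℝ :=
  invResidual (projY.compFormalMultilinearSeries q) projY r K k

/-- The residual in the `z`-component. -/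
def resZ (q : FormalMultilinearSeries ℝ (Phase d d') (Phase d d')) (r : ℕ → ℝ)
    (K : ℕ → Phase d d') (k : ℕ) : Fin d' → ℝ :=
  invResidual (projZ.compFormalMultilinearSeries q) projZ r K k

/-- The factor `n - N` combines `-N a`, from differentiating `-a x^N`, with `n a`, from `K ∘ r`. -/
theorem resX_top (hJ : IsSystemJet N M a B₁ B₂ C ℓ q) {r : ℕ → ℝ} (hr : IsTangentSeries N a r)
    {K : ℕ → Phase d d'} (hK : K 1 = unitX) {n : ℕ} (hn : 2 ≤ n) :
    resX q r K (n + N - 1) =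
      ((n : ℝ) - N) * a * (K n).1 + ℓ (K n).2 + resX q r (truncSeq n K) (n + N - 1) := by
  have hN := hJ.two_le.trans hJ.le
  rw [resX, invResidual_top _ _ hr hN (by omega) le_rfl hn hJ.order_x, hK, hJ.lin_x, if_pos rfl,
    resX]
  simp only [projX_apply, smul_eq_mul]
  ring

theorem resY_top (hJ : IsSystemJet N M a B₁ B₂ C ℓ q) {r : ℕ → ℝ} (hr : IsTangentSeries N a r)
    {K : ℕ → Phase d d'} (hK : K 1 = unitX) {n : ℕ} (hn : 2 ≤ n) :
    resY q r K (n + M - 1) =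
      (linY N M a B₁ n).mulVec (K n).2.1 + B₂.mulVec (K n).2.2 +
        resY q r (truncSeq n K) (n + M - 1) := by
  have hN := hJ.two_le.trans hJ.le
  have hM := hJ.two_le
  rw [resY, invResidual_top _ _ hr hN (by omega) hJ.le hn hJ.order_y, hK, hJ.lin_y, resY, linY]
  by_cases h : M = N
  · simp only [h, if_true, projY_apply, Matrix.add_mulVec, Matrix.smul_mulVec, Matrix.one_mulVec]
    abel
  · simp only [h, if_false, add_zero]

theorem resZ_top (hJ : IsSystemJet N M a B₁ B₂ C ℓ q) {r : ℕ → ℝ} (hr : IsTangentSeries N a r)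
    {K : ℕ → Phase d d'} (hK : K 1 = unitX) {n : ℕ} (hn : 2 ≤ n) :
    resZ q r K n = (C - 1).mulVec (K n).2.2 + resZ q r (truncSeq n K) n := by
  have hN := hJ.two_le.trans hJ.le
  have := invResidual_top (projZ.compFormalMultilinearSeries q) projZ hr hN le_rfl (by omega) hn
    hJ.order_z K
  rw [hK, hJ.lin_z, if_neg (by omega), add_zero] at this
  exact this

/-- In each component the orders below `m` are trivial and order `m` holds because `K 1 = unitX`: in
x the terms `-a` and `a` cancel. What remains, shifted by `m - 1`, is indexed by `n ≥ 2`. -/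
theorem invResidual_eq_zero_iff (hJ : IsSystemJet N M a B₁ B₂ C ℓ q) {r : ℕ → ℝ}
    (hr : IsTangentSeries N a r) {K : ℕ → Phase d d'} (hK0 : K 0 = 0) (hK : K 1 = unitX) :
    (∀ k, invResidual q (ContinuousLinearMap.id ℝ _) r K k = 0) ↔
      ∀ n, 2 ≤ n → resX q r K (n + N - 1) = 0 ∧ resY q r K (n + M - 1) = 0 ∧ resZ q r K n = 0 := by
  have hN := hJ.two_le.trans hJ.le
  have hM := hJ.two_le
  have hMN := hJ.le
  have hX : ∀ k, resX q r K k = (invResidual q (ContinuousLinearMap.id ℝ _) r K k).1 := fun k =>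
    invResidual_clm projX q r K k
  have hY : ∀ k, resY q r K k = (invResidual q (ContinuousLinearMap.id ℝ _) r K k).2.1 := fun k =>
    invResidual_clm projY q r K k
  have hZ : ∀ k, resZ q r K k = (invResidual q (ContinuousLinearMap.id ℝ _) r K k).2.2 := fun k =>
    invResidual_clm projZ q r K k
  constructor
  · intro h n _
    rw [hX, hY, hZ, h, h, h]
    exact ⟨rfl, rfl, rfl⟩
  · intro h k
    have h1 : resX q r K k = 0 := by
      rcases lt_trichotomy k N with hk | hk | hk
      · exact invResidual_of_lt _ _ hr le_rfl hk hJ.order_x hK0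
      · rw [hk, resX, invResidual_self _ _ hr hN (by omega) le_rfl hJ.order_x hK0, hK, hJ.diag_x]
        simp [unitX]
      · have := (h (k + 1 - N) (by omega)).1
        rwa [show k + 1 - N + N - 1 = k by omega] at this
    have h2 : resY q r K k = 0 := by
      rcases lt_trichotomy k M with hk | hk | hk
      · exact invResidual_of_lt _ _ hr hMN hk hJ.order_y hK0
      · rw [hk, resY, invResidual_self _ _ hr hN (by omega) hMN hJ.order_y hK0, hK, hJ.diag_y]
        simp [unitX]
      · have := (h (k + 1 - M) (by omega)).2.1
        rwa [show k + 1 - M + M - 1 = k by omega] at this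
    have h3 : resZ q r K k = 0 := by
      rcases lt_trichotomy k 1 with hk | hk | hk
      · exact invResidual_of_lt _ _ hr (by omega) hk hJ.order_z hK0
      · rw [hk, resZ, invResidual_self _ _ hr hN le_rfl (by omega) hJ.order_z hK0, hK, hJ.diag_z]
        simp [unitX]
      · exact (h k (by omega)).2.2
    rw [hX] at h1
    rw [hY] at h2
    rw [hZ] at h3
    exact Prod.ext h1 (Prod.ext h2 h3)

/-- The value of the `n`-th coefficient of the formal solution in terms of the previous ones. -/
def solutionStep (N M : ℕ) (a : ℝ) (B₁ : Matrix (Fin d) (Fin d) ℝ)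
    (B₂ : Matrix (Fin d) (Fin d') ℝ) (C : Matrix (Fin d') (Fin d') ℝ)
    (ℓ : ((Fin d → ℝ) × (Fin d' → ℝ)) →L[ℝ] ℝ)
    (q : FormalMultilinearSeries ℝ (Phase d d') (Phase d d')) (r : ℕ → ℝ) (c : ℝ)
    (n : ℕ) (K : ℕ → Phase d d') : Phase d d' :=
  if n = 0 then 0 else if n = 1 then unitX else
    let z := ((C - 1)⁻¹).mulVec (-resZ q r K n)
    let y := ((linY N M a B₁ n)⁻¹).mulVec (-resY q r K (n + M - 1) - B₂.mulVec z)
    (if n = N then c else (((n : ℝ) - N) * a)⁻¹ * (-resX q r K (n + N - 1) - ℓ (y, z)), y, z)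

/-- The obstruction in the resonant `x`-equation at order `2N - 1`. -/
def resonance (N : ℕ) (ℓ : ((Fin d → ℝ) × (Fin d' → ℝ)) →L[ℝ] ℝ)
    (q : FormalMultilinearSeries ℝ (Phase d d') (Phase d d')) (r : ℕ → ℝ)
    (K : ℕ → Phase d d') : ℝ :=
  ℓ (K N).2 + resX q r (truncSeq N K) (2 * N - 1)

theorem mulVec_add_eq_zero_iff {n : ℕ} {A : Matrix (Fin n) (Fin n) ℝ} (hA : IsUnit A)
    (v w : Fin n → ℝ) : A.mulVec v + w = 0 ↔ v = A⁻¹.mulVec (-w) := by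
  have hdet := (Matrix.isUnit_iff_isUnit_det A).1 hA
  rw [add_eq_zero_iff_eq_neg]
  constructor
  · intro h
    rw [← h, Matrix.mulVec_mulVec, Matrix.nonsing_inv_mul _ hdet, Matrix.one_mulVec]
  · intro h
    rw [h, Matrix.mulVec_mulVec, Matrix.mul_nonsing_inv _ hdet, Matrix.one_mulVec]

theorem solution_iff (hJ : IsSystemJet N M a B₁ B₂ C ℓ q) (ha : a ≠ 0)
    (hC : IsUnit (C - 1)) (hlin : ∀ n, 2 ≤ n → IsUnit (linY N M a B₁ n)) {r : ℕ → ℝ}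
    (hr : IsTangentSeries N a r) (c : ℝ) (K : ℕ → Phase d d') :
    (K 0 = 0 ∧ K 1 = unitX ∧ (K N).1 = c ∧
      ∀ k, invResidual q (ContinuousLinearMap.id ℝ _) r K k = 0) ↔
    (∀ n, K n = solutionStep N M a B₁ B₂ C ℓ q r c n (truncSeq n K)) ∧
      resonance N ℓ q r K = 0 := by
  have hN := hJ.two_le.trans hJ.le
  have hstep : ∀ n, 2 ≤ n → K 1 = unitX →
      ((resX q r K (n + N - 1) = 0 ∧ resY q r K (n + M - 1) = 0 ∧ resZ q r K n = 0 ∧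
        (n = N → (K N).1 = c)) ↔
      K n = solutionStep N M a B₁ B₂ C ℓ q r c n (truncSeq n K) ∧
        (n = N → resonance N ℓ q r K = 0)) := by
    intro n hn hK
    rw [resX_top hJ hr hK hn, resY_top hJ hr hK hn, resZ_top hJ hr hK hn, add_assoc (_ * _), add_assoc ((linY N M a B₁ n).mulVec _),
      mulVec_add_eq_zero_iff (hlin n hn), mulVec_add_eq_zero_iff hC, solutionStep,
      if_neg (by omega), if_neg (by omega)]
    rw [Prod.ext_iff, Prod.ext_iff, resonance, neg_add_rev, ← sub_eq_add_neg]
    -- At `n = N` the coefficient of `(K n).1` vanishes: the x-equation becomes the resonance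
    -- condition, and the normalization `c` supplies the missing value.
    by_cases h : n = N
    · subst h
      simp only [if_true, forall_const, sub_self, zero_mul, zero_add]
      rw [← two_mul]
      constructor
      · rintro ⟨h1, h2, h3, h4⟩
        rw [← h3]
        exact ⟨⟨h4, h2, rfl⟩, h1⟩
      · rintro ⟨⟨h1, h2, h3⟩, h4⟩
        rw [← h3] at h2
        exact ⟨h4, h2, h3, h1⟩
    · simp only [h, if_false, false_imp_iff, and_true]
      have hne : ((n : ℝ) - N) * a ≠ 0 :=
        mul_ne_zero (sub_ne_zero.2 (by exact_mod_cast h)) ha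
      constructor
      · rintro ⟨h1, h2, h3⟩
        rw [← h3, ← h2]
        refine ⟨?_, rfl, rfl⟩
        rw [eq_inv_mul_iff_mul_eq₀ hne]
        linarith
      · rintro ⟨h1, h2, h3⟩
        rw [← h3] at h2
        rw [← h3, ← h2, eq_inv_mul_iff_mul_eq₀ hne] at h1
        exact ⟨by linarith, h2, h3⟩
  constructor
  · rintro ⟨h0, h1, hc, h⟩
    rw [invResidual_eq_zero_iff hJ hr h0 h1] at h
    have h2 := fun n hn => (hstep n hn h1).1
      ⟨(h n hn).1, (h n hn).2.1, (h n hn).2.2, fun _ => hc⟩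
    refine ⟨fun n => ?_, (h2 N hN).2 rfl⟩
    rcases Nat.lt_or_ge n 2 with hn | hn
    · interval_cases n <;> simp [solutionStep, h0, h1]
    · exact (h2 n hn).1
  · rintro ⟨h, hres⟩
    have h0 : K 0 = 0 := by rw [h 0]; simp [solutionStep]
    have h1 : K 1 = unitX := by rw [h 1]; simp [solutionStep]
    have h2 := fun n hn => (hstep n hn h1).2 ⟨h n, fun _ => hres⟩
    refine ⟨h0, h1, (h2 N hN).2.2.2 rfl, ?_⟩
    rw [invResidual_eq_zero_iff hJ hr h0 h1]
    exact fun n hn => ⟨(h2 n hn).1, (h2 n hn).2.1, (h2 n hn).2.2.1⟩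

theorem powCoeff_reparam_congr {b b' : ℝ} {k j : ℕ} (h : k + 1 < 2 * N - 1 + j) :
    powCoeff (reparam N a b).coeff k j = powCoeff (reparam N a b').coeff k j := by
  refine powCoeff_congr fun i hi => ?_
  rw [coeff_reparam, coeff_reparam]
  simp only [show i ≠ 2 * N - 1 by omega, if_false]

/-- Everything the resonance uses is computed before `b` or `c` can matter, except for the single
term `b • K 1`, which is subtracted in the residual. Thus resonance plus `b` is an invariant of the
system. -/
theorem resonance_add_eq (hJ : IsSystemJet N M a B₁ B₂ C ℓ q) {b b' c c' : ℝ}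
    {K K' : ℕ → Phase d d'}
    (hK : ∀ n, K n = solutionStep N M a B₁ B₂ C ℓ q (reparam N a b).coeff c n (truncSeq n K))
    (hK' : ∀ n, K' n = solutionStep N M a B₁ B₂ C ℓ q (reparam N a b').coeff c' n
      (truncSeq n K')) :
    resonance N ℓ q (reparam N a b).coeff K + b = resonance N ℓ q (reparam N a b').coeff K' + b' := by
  have hN := hJ.two_le.trans hJ.le
  have hM := hJ.two_le
  have hMN := hJ.le
  have h0 : K 0 = 0 := by rw [hK 0]; simp [solutionStep]
  have h1 : K 1 = unitX := by rw [hK 1]; simp [solutionStep]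
  -- For `m ≤ N`, `b` can affect these residuals only through `j = 1`, `n = m = N`. When `n = N` the
  -- lemma is used for y and z alone, where `K 1` has zero component.
  have hres : ∀ {W : Type} [NormedAddCommGroup W] [NormedSpace ℝ W]
      (p : FormalMultilinearSeries ℝ (Phase d d') W) (π : Phase d d' →L[ℝ] W) (n m : ℕ),
      m ≤ N → (n < N ∨ n = N ∧ π unitX = 0) → (∀ j < n, K j = K' j) →
      invResidual p π (reparam N a b).coeff (truncSeq n K) (n + m - 1) =
        invResidual p π (reparam N a b').coeff (truncSeq n K') (n + m - 1) := by
    intro W _ _ p π n m hm hn hjK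
    rw [← truncSeq_congr hjK]
    refine invResidual_congr p π fun j => ?_
    rcases Nat.lt_or_ge j n with hj | hj
    · rw [truncSeq_of_lt hj]
      rcases Nat.eq_zero_or_pos j with hj0 | hj0
      · simp [hj0, h0]
      · rcases Nat.lt_or_ge 1 j with hj1 | hj1
        · exact Or.inl (powCoeff_reparam_congr (by omega))
        · obtain rfl : j = 1 := by omega
          rcases hn with hn | hn
          · exact Or.inl (powCoeff_reparam_congr (by omega))
          · exact Or.inr (by rw [h1, hn.2])
    · simp [truncSeq_of_le hj]
  have hlow : ∀ n < N, K n = K' n := by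
    intro n
    induction n using Nat.strong_induction_on with
    | _ n ih =>
      intro hn
      have ih' : ∀ j < n, K j = K' j := fun j hj => ih j hj (hj.trans hn)
      rw [hK, hK', solutionStep, solutionStep]
      have eX := hres (projX.compFormalMultilinearSeries q) projX n N le_rfl (Or.inl hn) ih'
      have eY := hres (projY.compFormalMultilinearSeries q) projY n M hMN (Or.inl hn) ih'
      have eZ := hres (projZ.compFormalMultilinearSeries q) projZ n 1 (by omega) (Or.inl hn) ih'
      simp only [Nat.add_sub_cancel] at eZ
      simp only [resX, resY, resZ, eX, eY, eZ, hn.ne, if_false]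
  have htop : (K N).2 = (K' N).2 := by
    rw [hK, hK', solutionStep, solutionStep, if_neg (by omega), if_neg (by omega),
      if_neg (by omega), if_neg (by omega)]
    have eY := hres (projY.compFormalMultilinearSeries q) projY N M hMN
      (Or.inr ⟨rfl, by simp [unitX]⟩) hlow
    have eZ := hres (projZ.compFormalMultilinearSeries q) projZ N 1 (by omega)
      (Or.inr ⟨rfl, by simp [unitX]⟩) hlow
    simp only [Nat.add_sub_cancel] at eZ
    simp only [resY, resZ, eY, eZ]
  have hx := invResidual_add_eq (projX.compFormalMultilinearSeries q) projX
    (r := (reparam N a b).coeff) (r' := (reparam N a b').coeff) (k := 2 * N - 1) (by omega)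
    (K := truncSeq N K) (fun j hj => by
      rcases Nat.eq_zero_or_pos j with hj0 | hj0
      · right
        rw [hj0, truncSeq_of_lt (by omega), h0, map_zero]
      · exact Or.inl (powCoeff_reparam_congr (by omega)))
  rw [truncSeq_of_lt (by omega), h1, coeff_reparam, coeff_reparam, if_neg (by omega),
    if_neg (by omega), if_pos rfl, if_pos rfl, truncSeq_congr hlow] at hx
  simp only [projX_apply, unitX, smul_eq_mul] at hx
  rw [resonance, resonance, resX, resX, htop, truncSeq_congr hlow]
  linarith

end

/-! ### Majorant sums and geometric growth -/

theorem sum_pow_sub_le {x : ℝ} (hx : 0 ≤ x) (hx' : x ≤ 1 / 2) (m L : ℕ) :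
    ∑ l ∈ Finset.Icc (m + 1) L, x ^ (l - m) ≤ 2 * x := by
  have h1 : ∀ k : ℕ, ∑ s ∈ Finset.range k, x ^ s ≤ 2 := by
    intro k
    have h2 := geom_sum_mul_neg x k
    have h3 : 0 ≤ ∑ s ∈ Finset.range k, x ^ s := Finset.sum_nonneg fun s _ => pow_nonneg hx s
    have h4 : 0 ≤ x ^ k := pow_nonneg hx k
    nlinarith
  have h5 : ∑ l ∈ Finset.Icc (m + 1) L, x ^ (l - m) = x * ∑ s ∈ Finset.range (L - m), x ^ s := by
    rw [← Finset.Ico_add_one_right_eq_Icc, Finset.sum_Ico_eq_sum_range, Finset.mul_sum,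
      show L + 1 - (m + 1) = L - m by omega]
    refine Finset.sum_congr rfl fun s _ => ?_
    rw [show m + 1 + s - m = s + 1 by omega, pow_succ']
  rw [h5]
  nlinarith [h1 (L - m)]

theorem sum_biUnion_le_sum {ι α : Type*} [DecidableEq ι] [DecidableEq α] (s : Finset ι)
    (t : ι → Finset α) {g : α → ℝ} (hg : ∀ x, 0 ≤ g x) :
    ∑ x ∈ s.biUnion t, g x ≤ ∑ i ∈ s, ∑ x ∈ t i, g x := by
  induction s using Finset.induction_on with
  | empty => simp
  | insert i s hi ih =>
    rw [Finset.biUnion_insert, Finset.sum_insert hi]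
    have h1 := Finset.sum_union_inter (s₁ := t i) (s₂ := s.biUnion t) (f := g)
    have h2 : 0 ≤ ∑ x ∈ t i ∩ s.biUnion t, g x := Finset.sum_nonneg fun x _ => hg x
    linarith

/-- The majorant of the nonlinear part at order `n + m - 1` of a component of order `m`. -/
def nonlinMajorant (β : ℝ) (u : ℕ → ℝ) (m n : ℕ) : ℝ :=
  ∑ l ∈ Finset.Icc m (n + m - 1),
    ∑ f ∈ (tuples l (n + m - 1)).filter (fun f => ∀ i, f i < n), β ^ l * ∏ i, u (f i)

section

variable {u : ℕ → ℝ} {r : ℝ}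

/-- The weight splits as `r^(n-1) = r^(l-m) ∏ r^(f i - 1)`. Different `n` give disjoint sets of
tuples, since the sum of a tuple determines `n`, so their union sits inside one box, where sums of
products factor. -/
theorem sum_tuples_le_sum_pi (hu : ∀ n, 0 ≤ u n) (hr : 0 < r) {l m P : ℕ} (hm : 1 ≤ m)
    (hl : m ≤ l) (Q : (Fin l → ℕ) → Prop) [DecidablePred Q]
    (hQ : ∀ n, 2 ≤ n → ∀ f ∈ tuples l (n + m - 1), (∀ i, f i < n) → Q f) :
    ∑ n ∈ Finset.Icc 2 P, r ^ (n - 1) *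
        ∑ f ∈ (tuples l (n + m - 1)).filter (fun f => ∀ i, f i < n), ∏ i, u (f i) ≤
      r ^ (l - m) * ∑ f ∈ (Fintype.piFinset fun _ : Fin l => Finset.Icc 1 (P - 1)).filter Q,
        ∏ i, (u (f i) * r ^ (f i - 1)) := by
  classical
  have h1 : ∀ n ∈ Finset.Icc 2 P, r ^ (n - 1) *
        ∑ f ∈ (tuples l (n + m - 1)).filter (fun f => ∀ i, f i < n), ∏ i, u (f i) =
      ∑ f ∈ (tuples l (n + m - 1)).filter (fun f => ∀ i, f i < n),
        r ^ (l - m) * ∏ i, (u (f i) * r ^ (f i - 1)) := by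
    intro n hn
    rw [Finset.mul_sum]
    refine Finset.sum_congr rfl fun f hf => ?_
    have h2 := sum_pred_of_mem_tuples (Finset.mem_filter.1 hf).1
    have h3 := (Finset.mem_Icc.1 hn).1
    rw [Finset.prod_mul_distrib, Finset.prod_pow_eq_pow_sum,
      show n - 1 = (l - m) + ∑ i, (f i - 1) by omega, pow_add]
    ring
  rw [Finset.sum_congr rfl h1, ← Finset.sum_biUnion, Finset.mul_sum]
  · refine Finset.sum_le_sum_of_subset_of_nonneg ?_ fun f _ _ => ?_
    · intro f hf
      obtain ⟨n, hn, hf⟩ := Finset.mem_biUnion.1 hf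
      obtain ⟨hf, hlt⟩ := Finset.mem_filter.1 hf
      have hn' := Finset.mem_Icc.1 hn
      refine Finset.mem_filter.2 ⟨Fintype.mem_piFinset.2 fun i => Finset.mem_Icc.2
        ⟨(mem_tuples.1 hf).1 i, ?_⟩, hQ n hn'.1 f hf hlt⟩
      have := hlt i
      omega
    · exact mul_nonneg (pow_nonneg hr.le _) (Finset.prod_nonneg fun i _ =>
        mul_nonneg (hu _) (pow_nonneg hr.le _))
  · intro n hn n' hn' hne
    refine Finset.disjoint_left.2 fun f hf hf' => hne ?_
    have h1 := (mem_tuples.1 (Finset.mem_filter.1 hf).1).2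
    have h2 := (mem_tuples.1 (Finset.mem_filter.1 hf').1).2
    omega

theorem exists_two_large_entries {m n : ℕ} (hm : 1 ≤ m) (hn : 2 ≤ n) {f : Fin m → ℕ}
    (hf : f ∈ tuples m (n + m - 1)) (hlt : ∀ i, f i < n) : ∃ i j, i ≠ j ∧ 2 ≤ f i ∧ 2 ≤ f j := by
  have h1 := sum_pred_of_mem_tuples hf
  have hi : ∃ i, 2 ≤ f i := by
    by_contra! hc
    have : ∑ i, (f i - 1) = 0 := Finset.sum_eq_zero fun i _ => by have := hc i; omega
    omega
  obtain ⟨i, hi⟩ := hi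
  by_contra! hc
  rw [← Finset.add_sum_erase _ _ (Finset.mem_univ i), Finset.sum_eq_zero (s := Finset.univ.erase i)]
    at h1
  · have := hlt i
    omega
  · intro j hj
    have := hc i j (Finset.ne_of_mem_erase hj).symm hi
    omega

theorem sum_Icc_one_le (hu1 : u 1 ≤ 1) (Q : ℕ)
    (hT0 : 0 ≤ ∑ j ∈ Finset.Icc 2 Q, u j * r ^ (j - 1)) :
    ∑ j ∈ Finset.Icc 1 Q, u j * r ^ (j - 1) ≤ 1 + ∑ j ∈ Finset.Icc 2 Q, u j * r ^ (j - 1) := by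
  rcases Nat.eq_zero_or_pos Q with h | h
  · subst h
    simp
  · rw [← Finset.add_sum_Ioc_eq_sum_Icc h]
    have : Finset.Ioc 1 Q = Finset.Icc 2 Q := by ext; simp; omega
    rw [this]
    simpa using hu1

/-- Union bound over the positions of two entries `≥ 2`: each of these contributes `T`, every other
position at most `1 + T`. -/
theorem sum_pi_two_large_le (hu : ∀ n, 0 ≤ u n) (hu1 : u 1 ≤ 1) (hr : 0 < r) (m Q : ℕ)
    {T : ℝ} (hT : T = ∑ j ∈ Finset.Icc 2 Q, u j * r ^ (j - 1)) :
    ∑ f ∈ (Fintype.piFinset fun _ : Fin m => Finset.Icc 1 Q).filter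
        (fun f => ∃ i j, i ≠ j ∧ 2 ≤ f i ∧ 2 ≤ f j), ∏ i, (u (f i) * r ^ (f i - 1)) ≤
      (m : ℝ) ^ 2 * (T ^ 2 * (1 + T) ^ m) := by
  classical
  have hterm : ∀ j, 0 ≤ u j * r ^ (j - 1) := fun j => mul_nonneg (hu j) (pow_nonneg hr.le _)
  have hT0 : 0 ≤ T := hT ▸ Finset.sum_nonneg fun j _ => hterm j
  have hS : ∑ j ∈ Finset.Icc 1 Q, u j * r ^ (j - 1) ≤ 1 + T := by
    rw [hT]
    exact sum_Icc_one_le hu1 Q (hT ▸ hT0)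
  let B : Fin m → Fin m → Fin m → Finset ℕ := fun i j x =>
    if x ∈ ({i, j} : Finset (Fin m)) then Finset.Icc 2 Q else Finset.Icc 1 Q
  have hsub : (Fintype.piFinset fun _ : Fin m => Finset.Icc 1 Q).filter
      (fun f => ∃ i j, i ≠ j ∧ 2 ≤ f i ∧ 2 ≤ f j) ⊆
      (Finset.univ.filter fun x : Fin m × Fin m => x.1 ≠ x.2).biUnion
        fun x => Fintype.piFinset (B x.1 x.2) := by
    intro f hf
    obtain ⟨hf, i, j, hij, hi, hj⟩ := Finset.mem_filter.1 hf
    refine Finset.mem_biUnion.2 ⟨(i, j), by simpa using hij, Fintype.mem_piFinset.2 fun x => ?_⟩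
    have hx := Finset.mem_Icc.1 (Fintype.mem_piFinset.1 hf x)
    by_cases h : x ∈ ({i, j} : Finset (Fin m))
    · simp only [B, h, if_true, Finset.mem_Icc]
      rw [Finset.mem_insert, Finset.mem_singleton] at h
      rcases h with h | h <;> subst h <;> exact ⟨by assumption, hx.2⟩
    · simp only [B, h, if_false, Finset.mem_Icc]
      exact hx
  have hpos : ∀ f : Fin m → ℕ, 0 ≤ ∏ i, (u (f i) * r ^ (f i - 1)) := fun f =>
    Finset.prod_nonneg fun i _ => hterm _
  refine (Finset.sum_le_sum_of_subset_of_nonneg hsub fun f _ _ => hpos f).trans ?_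
  refine (sum_biUnion_le_sum _ _ hpos).trans ?_
  have hpair : ∀ x ∈ Finset.univ.filter fun x : Fin m × Fin m => x.1 ≠ x.2,
      ∑ f ∈ Fintype.piFinset (B x.1 x.2), ∏ i, (u (f i) * r ^ (f i - 1)) ≤
        T ^ 2 * (1 + T) ^ m := by
    rintro ⟨i, j⟩ hx
    have hij : i ≠ j := (Finset.mem_filter.1 hx).2
    rw [← Finset.prod_univ_sum (B i j) fun _ k => u k * r ^ (k - 1)]
    have h1 : ∀ x ∈ Finset.univ, ∑ k ∈ B i j x, u k * r ^ (k - 1) ≤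
        (if x ∈ ({i, j} : Finset (Fin m)) then T else 1) * (1 + T) := by
      intro x _
      by_cases h : x ∈ ({i, j} : Finset (Fin m))
      · simp only [B, h, if_true, ← hT]
        nlinarith
      · simpa only [B, h, if_false, one_mul] using hS
    refine (Finset.prod_le_prod (fun x _ => Finset.sum_nonneg fun k _ => hterm k) h1).trans ?_
    rw [Finset.prod_mul_distrib, Finset.prod_ite_mem, Finset.univ_inter, Finset.prod_const,
      Finset.card_pair hij, Finset.prod_const, Finset.card_univ, Fintype.card_fin]
  refine (Finset.sum_le_card_nsmul _ _ _ hpair).trans ?_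
  rw [nsmul_eq_mul]
  refine mul_le_mul_of_nonneg_right ?_ (by positivity)
  calc (((Finset.univ.filter fun x : Fin m × Fin m => x.1 ≠ x.2).card : ℕ) : ℝ)
      ≤ ((m * m : ℕ) : ℝ) := by
        exact_mod_cast (Finset.card_filter_le _ _).trans (by simp)
    _ = (m : ℝ) ^ 2 := by push_cast; ring

/-- Tuples of length `m` have two entries `≥ 2` and are quadratic in `T`; longer ones carry
`r^(l-m)` and form a geometric tail of size `r`. `T` stops at `P - 1`, one short of the left side,
which lets an induction on `P` close. -/
theorem sum_nonlinMajorant_le (hu : ∀ n, 0 ≤ u n) (hu1 : u 1 ≤ 1) (hr : 0 < r) {β : ℝ}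
    (hβ : 0 < β) (hβr : 2 * β * r ≤ 1 / 2) {m : ℕ} (hm : 1 ≤ m) (P : ℕ) {T : ℝ}
    (hT : T = ∑ j ∈ Finset.Icc 2 (P - 1), u j * r ^ (j - 1)) (hT1 : T ≤ 1) :
    ∑ n ∈ Finset.Icc 2 P, r ^ (n - 1) * nonlinMajorant β u m n ≤
      (2 * β) ^ m * (m ^ 2 * T ^ 2 + 4 * β * r) := by
  have hterm : ∀ j, 0 ≤ u j * r ^ (j - 1) := fun j => mul_nonneg (hu j) (pow_nonneg hr.le _)
  have hT0 : 0 ≤ T := hT ▸ Finset.sum_nonneg fun j _ => hterm j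
  have hS : ∑ j ∈ Finset.Icc 1 (P - 1), u j * r ^ (j - 1) ≤ 2 := by
    have := sum_Icc_one_le hu1 (P - 1) (hT ▸ hT0)
    rw [← hT] at this
    linarith
  let Φ : ℕ → ℝ := fun l => ∑ n ∈ Finset.Icc 2 P, r ^ (n - 1) *
    ∑ f ∈ (tuples l (n + m - 1)).filter (fun f => ∀ i, f i < n), ∏ i, u (f i)
  have h1 : ∑ n ∈ Finset.Icc 2 P, r ^ (n - 1) * nonlinMajorant β u m n =
      ∑ l ∈ Finset.Icc m (P + m), β ^ l * Φ l := by
    rw [Finset.sum_congr rfl fun l _ => Finset.mul_sum (Finset.Icc 2 P) _ (β ^ l), Finset.sum_comm]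
    refine Finset.sum_congr rfl fun n hn => ?_
    rw [nonlinMajorant, Finset.mul_sum]
    have hn' := Finset.mem_Icc.1 hn
    refine (Finset.sum_subset (Finset.Icc_subset_Icc le_rfl
      (show n + m - 1 ≤ P + m by omega)) ?_).trans ?_
    · intro l hlP hl
      rw [Finset.mem_Icc] at hl
      have hl' := Finset.mem_Icc.1 hlP
      rw [tuples_eq_empty (by omega)]
      simp
    · refine Finset.sum_congr rfl fun l _ => ?_
      rw [← Finset.mul_sum]
      ring
  have h2 : Φ m ≤ 2 ^ m * (m ^ 2 * T ^ 2) := by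
    classical
    refine (sum_tuples_le_sum_pi hu hr hm le_rfl (fun f => ∃ i j, i ≠ j ∧ 2 ≤ f i ∧ 2 ≤ f j)
      fun n hn f hf hlt => exists_two_large_entries hm hn hf hlt).trans ?_
    rw [Nat.sub_self, pow_zero, one_mul]
    refine (sum_pi_two_large_le hu hu1 hr m (P - 1) hT).trans ?_
    have : (1 + T) ^ m ≤ 2 ^ m := pow_le_pow_left₀ (by positivity) (by linarith) m
    calc (m : ℝ) ^ 2 * (T ^ 2 * (1 + T) ^ m) ≤ (m : ℝ) ^ 2 * (T ^ 2 * 2 ^ m) := by gcongr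
      _ = _ := by ring
  have h3 : ∀ l ∈ Finset.Icc (m + 1) (P + m), β ^ l * Φ l ≤
      (2 * β) ^ m * (2 * β * r) ^ (l - m) := by
    intro l hl
    have hl' := (Finset.mem_Icc.1 hl).1
    have h4 : Φ l ≤ r ^ (l - m) * 2 ^ l := by
      classical
      refine (sum_tuples_le_sum_pi hu hr hm (by omega) (fun _ => True)
        fun _ _ _ _ _ => trivial).trans ?_
      rw [Finset.filter_true, ← Finset.prod_univ_sum (fun _ : Fin l => Finset.Icc 1 (P - 1))
        fun _ k => u k * r ^ (k - 1), Finset.prod_const, Finset.card_univ, Fintype.card_fin]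
      gcongr
      exact Finset.sum_nonneg fun k _ => hterm k
    calc β ^ l * Φ l ≤ β ^ l * (r ^ (l - m) * 2 ^ l) := by gcongr
      _ = (2 * β) ^ (m + (l - m)) * r ^ (l - m) := by
          rw [show m + (l - m) = l by omega, mul_pow]; ring
      _ = _ := by rw [pow_add, mul_pow (2 * β) r, mul_assoc]
  rw [h1, ← Finset.add_sum_Ioc_eq_sum_Icc (by omega)]
  have : Finset.Ioc m (P + m) = Finset.Icc (m + 1) (P + m) := by ext; simp
  rw [this]
  have h5 := Finset.sum_le_sum h3
  rw [← Finset.mul_sum] at h5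
  have h6 := sum_pow_sub_le (by positivity) hβr m (P + m)
  have h7 : (2 * β) ^ m * ∑ l ∈ Finset.Icc (m + 1) (P + m), (2 * β * r) ^ (l - m) ≤
      (2 * β) ^ m * (2 * (2 * β * r)) := by gcongr
  calc β ^ m * Φ m + ∑ l ∈ Finset.Icc (m + 1) (P + m), β ^ l * Φ l
      ≤ β ^ m * (2 ^ m * (m ^ 2 * T ^ 2)) + (2 * β) ^ m * (2 * (2 * β * r)) := by
        gcongr
        exact h5.trans h7
    _ = _ := by rw [mul_pow]; ring

theorem sum_linMajorant_le (hu : ∀ n, 0 ≤ u n) (hr : 0 < r) {G : ℝ} (hG : 0 < G)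
    (hGr : G * r ≤ 1 / 2) (P : ℕ) :
    ∑ n ∈ Finset.Icc 2 P, r ^ (n - 1) * ∑ j ∈ Finset.Ico 1 n, G ^ (n - j) * u j ≤
      2 * (G * r) * ∑ j ∈ Finset.Icc 1 (P - 1), u j * r ^ (j - 1) := by
  have h1 : ∑ n ∈ Finset.Icc 2 P, r ^ (n - 1) * ∑ j ∈ Finset.Ico 1 n, G ^ (n - j) * u j =
      ∑ j ∈ Finset.Icc 1 (P - 1), ∑ n ∈ Finset.Icc (j + 1) P,
        u j * r ^ (j - 1) * (G * r) ^ (n - j) := by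
    simp only [Finset.mul_sum]
    rw [Finset.sum_comm' (t' := Finset.Icc 1 (P - 1)) (s' := fun j => Finset.Icc (j + 1) P)]
    · refine Finset.sum_congr rfl fun j hj => Finset.sum_congr rfl fun n hn => ?_
      have hj' := Finset.mem_Icc.1 hj
      have hn' := Finset.mem_Icc.1 hn
      rw [show n - 1 = (j - 1) + (n - j) by omega, pow_add, mul_pow]
      ring
    · intro n j
      simp only [Finset.mem_Icc, Finset.mem_Ico]
      omega
  rw [h1, Finset.mul_sum]
  refine Finset.sum_le_sum fun j _ => ?_
  rw [← Finset.mul_sum, mul_comm]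
  have := sum_pow_sub_le (by positivity) hGr j P
  exact mul_le_mul_of_nonneg_right this (mul_nonneg (hu j) (pow_nonneg hr.le _))

end

/-- A sequence whose terms are controlled by the linear and nonlinear majorants of the previous
ones grows at most geometrically. -/
theorem exists_geometric_bound {ι : Type*} [Fintype ι] (ord : ι → ℕ) (hord : ∀ i, 1 ≤ ord i)
    {u : ℕ → ℝ} (hu : ∀ n, 0 ≤ u n) (hu1 : u 1 ≤ 1) {A G β : ℝ} (hA : 0 < A) (hG : 0 < G)
    (hβ : 0 < β) (n₀ : ℕ)
    (h : ∀ n, 2 ≤ n → n₀ < n → u n ≤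
      A * (∑ j ∈ Finset.Ico 1 n, G ^ (n - j) * u j + ∑ i, nonlinMajorant β u (ord i) n)) :
    ∃ ρ > 0, ∀ n, 1 ≤ n → u n ≤ ρ ^ n := by
  let D := ∑ j ∈ Finset.Icc 2 n₀, u j
  have hD : 0 ≤ D := Finset.sum_nonneg fun j _ => hu j
  let c₁ := D + A * (4 * G + ∑ i, (2 * β) ^ ord i * (4 * β))
  let c₂ := A * ∑ i, (2 * β) ^ ord i * (ord i : ℝ) ^ 2
  have hc₁ : 0 ≤ c₁ := by positivity
  have hc₂ : 0 ≤ c₂ := by positivity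
  -- The induction step will give `c₁ r + c₂ T²`. First `δ` is chosen with `c₂ δ² ≤ δ / 2`, then `r`
  -- so small that `c₁ r ≤ δ / 2`; the other summands in the denominator of `r` make the geometric
  -- tails converge.
  let δ := 1 / (2 * (c₂ + 1))
  have hδ : 0 < δ := by positivity
  have hδ1 : δ ≤ 1 := by
    rw [div_le_one (by positivity)]
    linarith
  have hδ2 : c₂ * δ ^ 2 ≤ δ / 2 := by
    have : δ * (2 * (c₂ + 1)) = 1 := by simp only [δ]; field_simp
    nlinarith
  let r := 1 / (1 + 2 * G + 4 * β + 2 * c₁ / δ)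
  have hden : 0 < 1 + 2 * G + 4 * β + 2 * c₁ / δ := by positivity
  have hr : 0 < r := by positivity
  have hr0 : r * (1 + 2 * G + 4 * β + 2 * c₁ / δ) = 1 := by simp only [r]; field_simp
  have e1 : 0 < r * G := by positivity
  have e2 : 0 < r * β := by positivity
  have e3 : 0 ≤ r * (2 * c₁ / δ) := by positivity
  have hr1 : r ≤ 1 := by nlinarith
  have hGr : G * r ≤ 1 / 2 := by nlinarith
  have hβr : 2 * β * r ≤ 1 / 2 := by nlinarith
  have hcr : c₁ * r ≤ δ / 2 := by
    have h1 : r * (2 * c₁ / δ) ≤ 1 := by nlinarith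
    have h2 : r * (2 * c₁ / δ) = (c₁ * r) / (δ / 2) := by field_simp
    rw [h2, div_le_one (by positivity)] at h1
    exact h1
  have hT : ∀ P, ∑ n ∈ Finset.Icc 2 P, u n * r ^ (n - 1) ≤ δ := by
    intro P
    induction P with
    | zero => simpa using hδ.le
    | succ P ih =>
      set T := ∑ n ∈ Finset.Icc 2 P, u n * r ^ (n - 1) with hTdef
      have hT0 : 0 ≤ T := Finset.sum_nonneg fun n _ => mul_nonneg (hu n) (pow_nonneg hr.le _)
      have hTdef' : T = ∑ n ∈ Finset.Icc 2 (P + 1 - 1), u n * r ^ (n - 1) := hTdef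
      have hS := sum_Icc_one_le hu1 P hT0
      rw [← hTdef] at hS
      have hpt : ∀ n ∈ Finset.Icc 2 (P + 1), u n * r ^ (n - 1) ≤
          (if n ≤ n₀ then u n * r else 0) +
            A * (r ^ (n - 1) * ∑ j ∈ Finset.Ico 1 n, G ^ (n - j) * u j +
              ∑ i, r ^ (n - 1) * nonlinMajorant β u (ord i) n) := by
        intro n hn
        have hn' := (Finset.mem_Icc.1 hn).1
        have hnl : ∀ i, 0 ≤ nonlinMajorant β u (ord i) n := fun i =>
          Finset.sum_nonneg fun l _ => Finset.sum_nonneg fun f _ =>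
            mul_nonneg (pow_nonneg hβ.le _) (Finset.prod_nonneg fun i _ => hu _)
        have hl : 0 ≤ ∑ j ∈ Finset.Ico 1 n, G ^ (n - j) * u j :=
          Finset.sum_nonneg fun j _ => mul_nonneg (pow_nonneg hG.le _) (hu j)
        by_cases hle : n ≤ n₀
        · rw [if_pos hle]
          have h1 : u n * r ^ (n - 1) ≤ u n * r := by
            refine mul_le_mul_of_nonneg_left ?_ (hu n)
            calc r ^ (n - 1) ≤ r ^ 1 := pow_le_pow_of_le_one hr.le hr1 (by omega)
              _ = r := pow_one r
          refine h1.trans (le_add_of_nonneg_right (mul_nonneg hA.le (add_nonneg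
            (mul_nonneg (pow_nonneg hr.le _) hl) (Finset.sum_nonneg fun i _ =>
              mul_nonneg (pow_nonneg hr.le _) (hnl i)))))
        · rw [if_neg hle, zero_add, ← Finset.mul_sum, ← mul_add]
          have := mul_le_mul_of_nonneg_left (h n hn' (by omega)) (pow_nonneg hr.le (n - 1))
          linarith
      have hsum := Finset.sum_le_sum hpt
      rw [Finset.sum_add_distrib, ← Finset.mul_sum, Finset.sum_add_distrib,
        Finset.sum_comm (s := Finset.Icc 2 (P + 1)) (t := Finset.univ)] at hsum
      have hs1 : ∑ n ∈ Finset.Icc 2 (P + 1), (if n ≤ n₀ then u n * r else 0) ≤ D * r := by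
        rw [← Finset.sum_filter, Finset.sum_mul]
        refine Finset.sum_le_sum_of_subset_of_nonneg ?_ fun n _ _ => mul_nonneg (hu n) hr.le
        intro n hn
        simp only [Finset.mem_filter, Finset.mem_Icc] at hn ⊢
        exact ⟨hn.1.1, hn.2⟩
      have hs2 := sum_linMajorant_le hu hr hG hGr (P + 1)
      rw [Nat.add_sub_cancel] at hs2
      have hs2' : ∑ n ∈ Finset.Icc 2 (P + 1), r ^ (n - 1) *
          ∑ j ∈ Finset.Ico 1 n, G ^ (n - j) * u j ≤ 4 * G * r := by
        refine hs2.trans ?_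
        nlinarith [mul_pos hG hr]
      have hs3 : ∑ i, ∑ n ∈ Finset.Icc 2 (P + 1), r ^ (n - 1) * nonlinMajorant β u (ord i) n ≤
          ∑ i, (2 * β) ^ ord i * ((ord i : ℝ) ^ 2 * T ^ 2 + 4 * β * r) :=
        Finset.sum_le_sum fun i _ => sum_nonlinMajorant_le hu hu1 hr hβ hβr (hord i) (P + 1)
          hTdef' (ih.trans hδ1)
      have hs3' : ∑ i, (2 * β) ^ ord i * ((ord i : ℝ) ^ 2 * T ^ 2 + 4 * β * r) =
          (∑ i, (2 * β) ^ ord i * (ord i : ℝ) ^ 2) * T ^ 2 +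
            (∑ i, (2 * β) ^ ord i * (4 * β)) * r := by
        rw [Finset.sum_mul, Finset.sum_mul, ← Finset.sum_add_distrib]
        exact Finset.sum_congr rfl fun i _ => by ring
      rw [hs3'] at hs3
      calc _ ≤ _ := hsum
        _ ≤ D * r + A * (4 * G * r + ((∑ i, (2 * β) ^ ord i * (ord i : ℝ) ^ 2) * T ^ 2 +
            (∑ i, (2 * β) ^ ord i * (4 * β)) * r)) := by gcongr
        _ = c₁ * r + c₂ * T ^ 2 := by simp only [c₁, c₂]; ring
        _ ≤ δ / 2 + c₂ * δ ^ 2 := by gcongr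
        _ ≤ δ := by linarith
  have hone : 1 ≤ 1 / r := by rw [le_div_iff₀ hr]; linarith
  refine ⟨1 / r, by positivity, fun n hn => ?_⟩
  rcases Nat.lt_or_ge n 2 with hn2 | hn2
  · obtain rfl : n = 1 := by omega
    rw [pow_one]
    linarith
  · have h1 : u n * r ^ (n - 1) ≤ 1 := by
      refine le_trans ?_ ((hT n).trans hδ1)
      exact Finset.single_le_sum (f := fun n => u n * r ^ (n - 1))
        (fun k _ => mul_nonneg (hu k) (pow_nonneg hr.le _)) (Finset.mem_Icc.2 ⟨hn2, le_rfl⟩)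
    calc u n ≤ 1 / r ^ (n - 1) := by rwa [le_div_iff₀ (by positivity)]
      _ = (1 / r) ^ (n - 1) := (one_div_pow r _).symm
      _ ≤ (1 / r) ^ n := pow_le_pow_right₀ hone (by omega)

/-! ### Factorial and power-coefficient estimates -/

/-- Excesses add under products of factorials; this is what bounds the product by `n!` rather than
by `(n + m - 1)!`. -/
theorem factorial_succ_mul_factorial_succ_le (p q : ℕ) : (p + 1)! * (q + 1)! ≤ (p + q + 1)! := by
  induction q with
  | zero => simp
  | succ q ih =>
    calc (p + 1)! * (q + 1 + 1)! = (q + 2) * ((p + 1)! * (q + 1)!) := by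
          rw [Nat.factorial_succ (q + 1)]; ring
      _ ≤ (p + q + 2) * (p + q + 1)! := Nat.mul_le_mul (by omega) ih
      _ = (p + (q + 1) + 1)! := (Nat.factorial_succ (p + q + 1)).symm

theorem prod_factorial_succ_le {ι : Type*} (s : Finset ι) (g : ι → ℕ) :
    ∏ i ∈ s, (g i + 1)! ≤ (∑ i ∈ s, g i + 1)! := by
  classical
  induction s using Finset.induction_on with
  | empty => simp
  | insert i s hi ih =>
    rw [Finset.prod_insert hi, Finset.sum_insert hi]
    exact (Nat.mul_le_mul le_rfl ih).trans (factorial_succ_mul_factorial_succ_le _ _)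

theorem prod_factorial_le_of_mem_tuples {l m n : ℕ} (hl : m ≤ l) {f : Fin l → ℕ}
    (hf : f ∈ tuples l (n + m - 1)) (hn : 1 ≤ n) : ∏ i, (f i)! ≤ n ! := by
  have h1 := sum_pred_of_mem_tuples hf
  have h2 : ∀ i, f i = f i - 1 + 1 := fun i => by
    have := (mem_tuples.1 hf).1 i
    omega
  rw [Finset.prod_congr rfl fun i _ => congrArg Nat.factorial (h2 i)]
  exact (prod_factorial_succ_le _ _).trans (Nat.factorial_le (by omega))

theorem pow_mul_factorial_le {j : ℕ} (hj : 1 ≤ j) (s : ℕ) :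
    ((j + s : ℕ) : ℝ) ^ s * (j ! : ℝ) ≤ Real.exp 1 ^ s * ((j + s)! : ℝ) := by
  induction s with
  | zero => simp
  | succ s ih =>
    have hpos : (0 : ℝ) < ((j + s : ℕ) : ℝ) := by exact_mod_cast (by omega : 0 < j + s)
    have h1 : (1 + 1 / ((j + s : ℕ) : ℝ)) ^ s ≤ Real.exp 1 := by
      have h2 : 1 + 1 / ((j + s : ℕ) : ℝ) ≤ Real.exp (1 / ((j + s : ℕ) : ℝ)) := by
        rw [add_comm]
        exact Real.add_one_le_exp _
      calc (1 + 1 / ((j + s : ℕ) : ℝ)) ^ s ≤ Real.exp (1 / ((j + s : ℕ) : ℝ)) ^ s := by gcongr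
        _ = Real.exp (s * (1 / ((j + s : ℕ) : ℝ))) := (Real.exp_nat_mul _ _).symm
        _ ≤ Real.exp 1 := by
          rw [Real.exp_le_exp, mul_one_div, div_le_one hpos]
          exact_mod_cast (by omega : s ≤ j + s)
    have h3 : ((j + (s + 1) : ℕ) : ℝ) = ((j + s : ℕ) : ℝ) * (1 + 1 / ((j + s : ℕ) : ℝ)) := by
      field_simp
      push_cast
      ring
    have h4 : ((j + (s + 1))! : ℝ) = ((j + (s + 1) : ℕ) : ℝ) * ((j + s)! : ℝ) := by
      rw [← add_assoc, Nat.factorial_succ]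
      push_cast
      ring
    calc ((j + (s + 1) : ℕ) : ℝ) ^ (s + 1) * (j ! : ℝ)
        = ((j + (s + 1) : ℕ) : ℝ) *
          ((1 + 1 / ((j + s : ℕ) : ℝ)) ^ s * (((j + s : ℕ) : ℝ) ^ s * (j ! : ℝ))) := by
          rw [pow_succ', mul_assoc]
          congr 1
          rw [h3, mul_pow]
          ring
      _ ≤ ((j + (s + 1) : ℕ) : ℝ) * (Real.exp 1 * (Real.exp 1 ^ s * ((j + s)! : ℝ))) := by
          gcongr
      _ = Real.exp 1 ^ (s + 1) * ((j + (s + 1))! : ℝ) := by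
          rw [h4]; ring

/-- A Cauchy estimate with the coefficients replaced by their absolute values. -/
theorem abs_powCoeff_le_pow {r : ℕ → ℝ} {t : ℝ} (ht : 0 < t) (k j : ℕ) :
    |powCoeff r k j| * t ^ k ≤ (∑ i ∈ Finset.Icc 1 k, |r i| * t ^ i) ^ j := by
  calc |powCoeff r k j| * t ^ k ≤ (∑ f ∈ tuples j k, ∏ i, |r (f i)|) * t ^ k := by
        refine mul_le_mul_of_nonneg_right ?_ (by positivity)
        refine (Finset.abs_sum_le_sum_abs _ _).trans (le_of_eq ?_)
        exact Finset.sum_congr rfl fun f _ => Finset.abs_prod _ _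
    _ = ∑ f ∈ tuples j k, ∏ i, (|r (f i)| * t ^ f i) := by
        rw [Finset.sum_mul]
        refine Finset.sum_congr rfl fun f hf => ?_
        rw [Finset.prod_mul_distrib, Finset.prod_pow_eq_pow_sum, (mem_tuples.1 hf).2]
    _ ≤ ∑ f ∈ Fintype.piFinset fun _ : Fin j => Finset.Icc 1 k, ∏ i, (|r (f i)| * t ^ f i) :=
        Finset.sum_le_sum_of_subset_of_nonneg (Finset.filter_subset _ _) fun f _ _ =>
          Finset.prod_nonneg fun i _ => by positivity
    _ = _ := by
        rw [← Finset.prod_univ_sum (fun _ : Fin j => Finset.Icc 1 k) fun _ i => |r i| * t ^ i]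
        simp

/-- Cauchy's estimate at `t = k^(-1/(N-1))`. Then `t^(N-1) = 1/k`, the majorant is at most `t (1 +
(|a| + |b|)/k)`, and its `j`-th power with `j ≤ k` costs only `exp (|a| + |b|)`. -/
theorem abs_powCoeff_reparam_le {N : ℕ} (hN : 2 ≤ N) (a b : ℝ) {k j : ℕ} (hk : 1 ≤ k)
    (hjk : j ≤ k) : |powCoeff (reparam N a b).coeff k j| ≤
      Real.exp (|a| + |b|) * (k : ℝ) ^ (((k - j : ℕ) : ℝ) / ((N : ℝ) - 1)) := by
  have hN1 : (0 : ℝ) < (N : ℝ) - 1 := by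
    have : (2 : ℝ) ≤ N := by exact_mod_cast hN
    linarith
  have hk0 : (0 : ℝ) < k := by exact_mod_cast hk
  have hk1 : (1 : ℝ) ≤ k := by exact_mod_cast hk
  let x : ℝ := (k : ℝ) ^ (1 / ((N : ℝ) - 1))
  have hx : 0 < x := Real.rpow_pos_of_pos hk0 _
  have hxN : x ^ (N - 1) = k := by
    rw [← Real.rpow_natCast, ← Real.rpow_mul hk0.le, Nat.cast_sub (by omega), Nat.cast_one,
      one_div_mul_cancel hN1.ne', Real.rpow_one]
  let t := x⁻¹
  have ht : 0 < t := inv_pos.2 hx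
  have htN : t ^ (N - 1) = 1 / k := by
    rw [inv_pow, hxN, one_div]
  have hsum : ∑ i ∈ Finset.Icc 1 k, |(reparam N a b).coeff i| * t ^ i ≤
      t * Real.exp ((|a| + |b|) / k) := by
    have hpt : ∀ i ∈ Finset.Icc 1 k, |(reparam N a b).coeff i| * t ^ i ≤
        (if i = 1 then t ^ 1 else 0) + (if i = N then |a| * t ^ N else 0) +
          (if i = 2 * N - 1 then |b| * t ^ (2 * N - 1) else 0) := by
      intro i _
      rw [coeff_reparam]
      have h1 : |(if i = 1 then (1 : ℝ) else 0) - (if i = N then a else 0) +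
          (if i = 2 * N - 1 then b else 0)| ≤ (if i = 1 then 1 else 0) +
            (if i = N then |a| else 0) + (if i = 2 * N - 1 then |b| else 0) := by
        refine (abs_add_le _ _).trans (add_le_add ((abs_sub _ _).trans (add_le_add ?_ ?_)) ?_) <;>
          split_ifs <;> simp
      refine (mul_le_mul_of_nonneg_right h1 (by positivity)).trans (le_of_eq ?_)
      rw [add_mul, add_mul]
      congr 1
      · congr 1 <;> split_ifs with h <;> simp [h]
      · split_ifs with h <;> simp [h]
    refine (Finset.sum_le_sum hpt).trans ?_
    rw [Finset.sum_add_distrib, Finset.sum_add_distrib, Finset.sum_ite_eq', Finset.sum_ite_eq',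
      Finset.sum_ite_eq']
    have e1 : t ^ N = t * (1 / k) := by
      rw [← htN, ← pow_succ', show N - 1 + 1 = N by omega]
    have e2 : t ^ (2 * N - 1) = t * (1 / k) * (1 / k) := by
      rw [← htN, ← pow_succ', ← pow_add]
      congr 1
      omega
    have e3 : 1 / (k : ℝ) ≤ 1 := by rw [div_le_one hk0]; exact hk1
    have e4 : t * (1 / k) * (1 / k) ≤ t * (1 / k) := mul_le_of_le_one_right (by positivity) e3
    calc _ ≤ t ^ 1 + |a| * t ^ N + |b| * t ^ (2 * N - 1) := by
          refine add_le_add (add_le_add ?_ ?_) ?_ <;> split_ifs <;> first | exact le_rfl | positivity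
      _ ≤ t + |a| * (t * (1 / k)) + |b| * (t * (1 / k)) := by
          rw [e1, e2, pow_one]
          gcongr
      _ = t * ((|a| + |b|) / k + 1) := by ring
      _ ≤ _ := by
          gcongr
          exact Real.add_one_le_exp _
  have h0 : 0 ≤ ∑ i ∈ Finset.Icc 1 k, |(reparam N a b).coeff i| * t ^ i :=
    Finset.sum_nonneg fun i _ => by positivity
  have h1 : |powCoeff (reparam N a b).coeff k j| * t ^ k ≤ t ^ j * Real.exp (|a| + |b|) := by
    refine (abs_powCoeff_le_pow ht k j).trans ((pow_le_pow_left₀ h0 hsum j).trans ?_)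
    rw [mul_pow, ← Real.exp_nat_mul]
    gcongr
    rw [mul_div_assoc', div_le_iff₀ hk0, mul_comm]
    gcongr
  have h2 : t ^ k = t ^ j * t ^ (k - j) := by rw [← pow_add]; congr 1; omega
  have h3 : (k : ℝ) ^ (((k - j : ℕ) : ℝ) / ((N : ℝ) - 1)) = (t ^ (k - j))⁻¹ := by
    rw [inv_pow, inv_inv, ← Real.rpow_natCast, ← Real.rpow_mul hk0.le]
    congr 1
    ring
  rw [h3, ← div_eq_mul_inv, le_div_iff₀ (by positivity)]
  rw [h2] at h1
  have h4 : 0 < t ^ j := by positivity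
  nlinarith

/-! ### Weighted bounds on the residual -/

/-- The weight gained by dividing by the linear part of a component of order `m`. -/
def stepWeight (N m n : ℕ) : ℝ := if m = N then n else 1

theorem one_le_stepWeight {N m n : ℕ} (hn : 1 ≤ n) : 1 ≤ stepWeight N m n := by
  rw [stepWeight]
  split_ifs
  · exact_mod_cast hn
  · exact le_rfl

/-- With `s = n - j` and `k = n + m - 1 ≤ N n`, the power `k^(s γ)` is absorbed by `(n! / j!)^γ` up
to `(N e)^γ` per step, and the extra power of `k` allowed when `m = N` becomes the step weight. If
`s + m < N` the coefficient vanishes. -/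
theorem abs_powCoeff_mul_factorial_rpow_le {N m : ℕ} (hN : 2 ≤ N) (hm : 1 ≤ m) (hmN : m ≤ N)
    (a b : ℝ) {γ : ℝ} (hγ0 : 0 ≤ γ)
    (hγ : ∀ s : ℕ, 1 ≤ s → N ≤ s + m →
      ((s + m - 1 : ℕ) : ℝ) / ((N : ℝ) - 1) ≤ s * γ + if m = N then 1 else 0)
    {n j : ℕ} (hj : 1 ≤ j) (hjn : j < n) :
    |powCoeff (reparam N a b).coeff (n + m - 1) j| * (j ! : ℝ) ^ γ ≤
      Real.exp (|a| + |b|) * N * ((N * Real.exp 1) ^ γ) ^ (n - j) *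
        (stepWeight N m n * (n ! : ℝ) ^ γ) := by
  obtain ⟨s, rfl⟩ : ∃ s, n = j + s := ⟨n - j, by omega⟩
  have hsw := one_le_stepWeight (N := N) (m := m) (n := j + s) (by omega)
  have hN1 : (1 : ℝ) ≤ N := by exact_mod_cast (by omega : 1 ≤ N)
  rcases Nat.lt_or_ge (s + m) N with h | h
  · rw [(isTangentSeries_reparam hN a b).powCoeff_gap (by omega) (by omega), abs_zero, zero_mul]
    positivity
  have hk1 : (1 : ℝ) ≤ ((j + s + m - 1 : ℕ) : ℝ) := by exact_mod_cast (by omega : 1 ≤ j + s + m - 1)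
  have hkN : ((j + s + m - 1 : ℕ) : ℝ) ≤ N * ((j + s : ℕ) : ℝ) := by
    have : j + s + m - 1 ≤ N * (j + s) := by
      obtain ⟨N', rfl⟩ : ∃ N', N = N' + 1 := ⟨N - 1, by omega⟩
      nlinarith [Nat.mul_le_mul_left N' (by omega : 1 ≤ j + s), Nat.sub_add_cancel hm,
        (by omega : j + s + m - 1 = j + s + (m - 1))]
    exact_mod_cast this
  have h1 := abs_powCoeff_reparam_le hN a b (k := j + s + m - 1) (j := j) (by omega) (by omega)
  have h2 : ((j + s + m - 1 : ℕ) : ℝ) ^ (((j + s + m - 1 - j : ℕ) : ℝ) / ((N : ℝ) - 1)) ≤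
      (N * ((j + s : ℕ) : ℝ)) ^ (s * γ) * (N * stepWeight N m (j + s)) := by
    rw [show j + s + m - 1 - j = s + m - 1 by omega]
    refine (Real.rpow_le_rpow_of_exponent_le hk1 (hγ s (by omega) h)).trans ?_
    rw [Real.rpow_add (by linarith)]
    refine mul_le_mul (Real.rpow_le_rpow (by linarith) hkN (by positivity)) ?_
      (by positivity) (by positivity)
    rw [stepWeight]
    split_ifs
    · rw [Real.rpow_one]
      exact hkN
    · simpa using hN1
  have h3 : (N * ((j + s : ℕ) : ℝ)) ^ (s * γ) * (j ! : ℝ) ^ γ ≤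
      ((N * Real.exp 1) ^ γ) ^ s * ((j + s)! : ℝ) ^ γ := by
    have e : ((N * Real.exp 1) ^ γ) ^ s = ((N * Real.exp 1) ^ s) ^ γ := by
      rw [← Real.rpow_natCast, ← Real.rpow_mul (by positivity), mul_comm γ,
        Real.rpow_mul (by positivity), Real.rpow_natCast]
    rw [e, Real.rpow_mul (by positivity), Real.rpow_natCast,
      ← Real.mul_rpow (by positivity) (by positivity),
      ← Real.mul_rpow (by positivity) (by positivity)]
    refine Real.rpow_le_rpow (by positivity) ?_ hγ0
    rw [mul_pow, mul_pow, mul_assoc, mul_assoc]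
    gcongr ?_ * ?_
    exact pow_mul_factorial_le hj s
  rw [Nat.add_sub_cancel_left]
  calc |powCoeff (reparam N a b).coeff (j + s + m - 1) j| * (j ! : ℝ) ^ γ
      ≤ Real.exp (|a| + |b|) * ((N * ((j + s : ℕ) : ℝ)) ^ (s * γ) *
          (N * stepWeight N m (j + s))) * (j ! : ℝ) ^ γ := by
        refine mul_le_mul_of_nonneg_right (h1.trans ?_) (by positivity)
        exact mul_le_mul_of_nonneg_left h2 (by positivity)
    _ = Real.exp (|a| + |b|) * N * stepWeight N m (j + s) *
          ((N * ((j + s : ℕ) : ℝ)) ^ (s * γ) * (j ! : ℝ) ^ γ) := by ring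
    _ ≤ Real.exp (|a| + |b|) * N * stepWeight N m (j + s) *
          (((N * Real.exp 1) ^ γ) ^ s * ((j + s)! : ℝ) ^ γ) := by gcongr
    _ = _ := by ring

theorem norm_invResidual_truncSeq_le {V W : Type*} [NormedAddCommGroup V] [NormedSpace ℝ V]
    [NormedAddCommGroup W] [NormedSpace ℝ W] (p : FormalMultilinearSeries ℝ V W) (π : V →L[ℝ] W)
    {N m : ℕ} (hN : 2 ≤ N) (hm : 1 ≤ m) (hmN : m ≤ N) (a b : ℝ) {γ : ℝ} (hγ0 : 0 ≤ γ)
    (hγ : ∀ s : ℕ, 1 ≤ s → N ≤ s + m →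
      ((s + m - 1 : ℕ) : ℝ) / ((N : ℝ) - 1) ≤ s * γ + if m = N then 1 else 0)
    {A β : ℝ} (hA : 0 ≤ A) (hβ : 0 ≤ β) (hp : ∀ l, ‖p l‖ ≤ A * β ^ l) (hpm : ∀ l < m, p l = 0)
    {K : ℕ → V} (hK : K 0 = 0) {u : ℕ → ℝ} (hu : ∀ j, u j = ‖K j‖ / (j ! : ℝ) ^ γ)
    {n : ℕ} (hn : 2 ≤ n) :
    ‖invResidual p π (reparam N a b).coeff (truncSeq n K) (n + m - 1)‖ ≤
      (A + Real.exp (|a| + |b|) * N * ‖π‖) * (stepWeight N m n * (n ! : ℝ) ^ γ *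
        (∑ j ∈ Finset.Ico 1 n, ((N * Real.exp 1) ^ γ) ^ (n - j) * u j +
          nonlinMajorant β u m n)) := by
  have hw : ∀ j : ℕ, 0 < (j ! : ℝ) ^ γ := fun j =>
    Real.rpow_pos_of_pos (by exact_mod_cast j.factorial_pos) _
  have hKu : ∀ j, ‖K j‖ = u j * (j ! : ℝ) ^ γ := fun j => by
    rw [hu, div_mul_cancel₀ _ (hw j).ne']
  have hu0 : ∀ j, 0 ≤ u j := fun j => by
    rw [hu]
    exact div_nonneg (norm_nonneg _) (hw j).le
  have hsw := one_le_stepWeight (N := N) (m := m) (n := n) (by omega)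
  have hnl0 : 0 ≤ nonlinMajorant β u m n :=
    Finset.sum_nonneg fun l _ => Finset.sum_nonneg fun f _ =>
      mul_nonneg (pow_nonneg hβ _) (Finset.prod_nonneg fun i _ => hu0 _)
  have hlin0 : 0 ≤ ∑ j ∈ Finset.Ico 1 n, ((N * Real.exp 1) ^ γ) ^ (n - j) * u j :=
    Finset.sum_nonneg fun j _ => mul_nonneg (by positivity) (hu0 j)
  have h1 : ‖compCoeff p (truncSeq n K) (n + m - 1)‖ ≤
      A * ((n ! : ℝ) ^ γ * nonlinMajorant β u m n) := by
    have e1 : compCoeff p (truncSeq n K) (n + m - 1) =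
        ∑ l ∈ Finset.Icc m (n + m - 1),
          ∑ f ∈ (tuples l (n + m - 1)).filter (fun f => ∀ i, f i < n), p l fun i => K (f i) := by
      rw [compCoeff]
      symm
      refine (Finset.sum_congr rfl fun l _ => ?_).trans (Finset.sum_subset
        (fun l hl => by rw [Finset.mem_Icc] at hl; rw [Finset.mem_range]; omega) fun l hl hl' => ?_)
      · have e2 : ∀ f ∈ tuples l (n + m - 1), p l (fun i => truncSeq n K (f i)) ≠ 0 →
            ∀ i, f i < n := by
          intro f _ hne i
          by_contra hi
          exact hne ((p l).map_coord_zero i (truncSeq_of_le (not_lt.1 hi) K))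
        refine (Finset.sum_congr rfl fun f hf => ?_).trans (Finset.sum_filter_of_ne e2)
        congr 1
        funext i
        rw [truncSeq_of_lt ((Finset.mem_filter.1 hf).2 i)]
      · rw [Finset.mem_range] at hl
        rw [Finset.mem_Icc] at hl'
        rw [hpm l (by omega)]
        simp
    rw [e1, nonlinMajorant, Finset.mul_sum, Finset.mul_sum]
    refine norm_sum_le_of_le _ fun l hl => ?_
    rw [Finset.mul_sum, Finset.mul_sum]
    refine norm_sum_le_of_le _ fun f hf => ?_
    have e2 : ∏ i, ((f i)! : ℝ) ^ γ ≤ (n ! : ℝ) ^ γ := by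
      rw [Real.finsetProd_rpow _ _ fun i _ => by positivity]
      refine Real.rpow_le_rpow (by positivity) ?_ hγ0
      exact_mod_cast prod_factorial_le_of_mem_tuples (Finset.mem_Icc.1 hl).1
        (Finset.mem_filter.1 hf).1 (by omega)
    have e3 : 0 ≤ ∏ i, u (f i) := Finset.prod_nonneg fun i _ => hu0 _
    calc ‖p l fun i => K (f i)‖ ≤ ‖p l‖ * ∏ i, ‖K (f i)‖ := (p l).le_opNorm _
      _ ≤ A * β ^ l * ∏ i, ‖K (f i)‖ := by
        gcongr
        exact hp l
      _ = A * β ^ l * ((∏ i, u (f i)) * ∏ i, ((f i)! : ℝ) ^ γ) := by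
        simp only [hKu, Finset.prod_mul_distrib]
      _ ≤ A * β ^ l * ((∏ i, u (f i)) * (n ! : ℝ) ^ γ) := by gcongr
      _ = _ := by ring
  have h2 : ‖∑ j ∈ Finset.range (n + m - 1 + 1),
      (powCoeff (reparam N a b).coeff (n + m - 1) j - if j = n + m - 1 then 1 else 0) •
        π (truncSeq n K j)‖ ≤ Real.exp (|a| + |b|) * N * ‖π‖ * (stepWeight N m n * (n ! : ℝ) ^ γ *
          ∑ j ∈ Finset.Ico 1 n, ((N * Real.exp 1) ^ γ) ^ (n - j) * u j) := by
    rw [← Finset.sum_subset (s₁ := Finset.Ico 1 n), Finset.mul_sum, Finset.mul_sum]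
    · refine norm_sum_le_of_le _ fun j hj => ?_
      obtain ⟨hj1, hjn⟩ := Finset.mem_Ico.1 hj
      rw [truncSeq_of_lt hjn, if_neg (by omega), sub_zero, norm_smul, Real.norm_eq_abs]
      have h3 := abs_powCoeff_mul_factorial_rpow_le hN hm hmN a b hγ0 hγ hj1 hjn
      calc |powCoeff (reparam N a b).coeff (n + m - 1) j| * ‖π (K j)‖
          ≤ |powCoeff (reparam N a b).coeff (n + m - 1) j| * (‖π‖ * ‖K j‖) := by
            gcongr
            exact π.le_opNorm _
        _ = (|powCoeff (reparam N a b).coeff (n + m - 1) j| * (j ! : ℝ) ^ γ) * (‖π‖ * u j) := by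
            rw [hKu]; ring
        _ ≤ (Real.exp (|a| + |b|) * N * ((N * Real.exp 1) ^ γ) ^ (n - j) *
              (stepWeight N m n * (n ! : ℝ) ^ γ)) * (‖π‖ * u j) :=
            mul_le_mul_of_nonneg_right h3 (mul_nonneg (norm_nonneg _) (hu0 j))
        _ = _ := by ring
    · intro j hj
      rw [Finset.mem_Ico] at hj
      rw [Finset.mem_range]
      omega
    · intro j _ hj
      rw [Finset.mem_Ico] at hj
      rcases Nat.eq_zero_or_pos j with h | h
      · simp [h, truncSeq, hK]
      · rw [truncSeq_of_le (by omega), map_zero, smul_zero]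
  rw [invResidual]
  refine (norm_sub_le _ _).trans ((add_le_add h1 h2).trans ?_)
  have hc : 0 ≤ Real.exp (|a| + |b|) * N * ‖π‖ := by positivity
  have hwn := (hw n).le
  have h3 : (n ! : ℝ) ^ γ * nonlinMajorant β u m n ≤
      stepWeight N m n * (n ! : ℝ) ^ γ * nonlinMajorant β u m n := by
    refine mul_le_mul_of_nonneg_right ?_ hnl0
    exact le_mul_of_one_le_left hwn hsw
  have h4 : 0 ≤ stepWeight N m n * (n ! : ℝ) ^ γ := by positivity
  calc _ ≤ A * (stepWeight N m n * (n ! : ℝ) ^ γ * nonlinMajorant β u m n) +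
        Real.exp (|a| + |b|) * N * ‖π‖ * (stepWeight N m n * (n ! : ℝ) ^ γ *
          ∑ j ∈ Finset.Ico 1 n, ((N * Real.exp 1) ^ γ) ^ (n - j) * u j) := by gcongr
    _ ≤ A * (stepWeight N m n * (n ! : ℝ) ^ γ *
          (∑ j ∈ Finset.Ico 1 n, ((N * Real.exp 1) ^ γ) ^ (n - j) * u j +
            nonlinMajorant β u m n)) +
        Real.exp (|a| + |b|) * N * ‖π‖ * (stepWeight N m n * (n ! : ℝ) ^ γ *
          (∑ j ∈ Finset.Ico 1 n, ((N * Real.exp 1) ^ γ) ^ (n - j) * u j +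
            nonlinMajorant β u m n)) := by
        gcongr
        · exact le_add_of_nonneg_left hlin0
        · exact le_add_of_nonneg_right hnl0
    _ = _ := by ring

/-! ### Lower bounds for the linear parts, and the exponent -/

theorem exists_norm_mulVec_le {m n : ℕ} (A : Matrix (Fin m) (Fin n) ℝ) :
    ∃ c > 0, ∀ v, ‖A.mulVec v‖ ≤ c * ‖v‖ := by
  let L := (Matrix.mulVecLin A).toContinuousLinearMap
  refine ⟨‖L‖ + 1, by positivity, fun v => ?_⟩
  calc ‖A.mulVec v‖ = ‖L v‖ := rfl
    _ ≤ ‖L‖ * ‖v‖ := L.le_opNorm v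
    _ ≤ _ := by gcongr; linarith

theorem exists_norm_le_mulVec {n : ℕ} {A : Matrix (Fin n) (Fin n) ℝ} (hA : IsUnit A) :
    ∃ c > 0, ∀ v, ‖v‖ ≤ c * ‖A.mulVec v‖ := by
  obtain ⟨c, hc, h⟩ := exists_norm_mulVec_le A⁻¹
  refine ⟨c, hc, fun v => ?_⟩
  have := h (A.mulVec v)
  rwa [Matrix.mulVec_mulVec, Matrix.nonsing_inv_mul _ ((Matrix.isUnit_iff_isUnit_det A).1 hA),
    Matrix.one_mulVec] at this

/-- For `M < N` the inverse of `B₁` is fixed and nothing is gained. For `M = N` and large `n`, `n a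
Id` dominates `B₁`, which gains a factor `n`. -/
theorem exists_stepWeight_mul_norm_le {d N M : ℕ} {a : ℝ} (ha : a ≠ 0)
    {B₁ : Matrix (Fin d) (Fin d) ℝ} (hMN : M ≤ N) (hB : M < N → IsUnit B₁) :
    ∃ c > 0, ∃ n₀ : ℕ, ∀ n, n₀ < n → ∀ v,
      stepWeight N M n * ‖v‖ ≤ c * ‖(linY N M a B₁ n).mulVec v‖ := by
  rcases hMN.lt_or_eq with h | h
  · obtain ⟨c, hc, hv⟩ := exists_norm_le_mulVec (hB h)
    refine ⟨c, hc, 0, fun n _ v => ?_⟩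
    simpa [stepWeight, linY, h.ne] using hv v
  · obtain ⟨c, hc, hv⟩ := exists_norm_mulVec_le B₁
    have ha' : 0 < |a| := abs_pos.2 ha
    obtain ⟨n₀, hn₀⟩ := exists_nat_gt (2 * c / |a|)
    refine ⟨2 / |a|, by positivity, n₀, fun n hn v => ?_⟩
    have h1 : 2 * c / |a| < n := hn₀.trans (by exact_mod_cast hn)
    rw [div_lt_iff₀ ha'] at h1
    have h2 : (linY N M a B₁ n).mulVec v = B₁.mulVec v + ((n : ℝ) * a) • v := by
      simp [linY, h, Matrix.add_mulVec, Matrix.smul_mulVec]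
    have h3 : ‖((n : ℝ) * a) • v‖ = n * |a| * ‖v‖ := by
      rw [norm_smul, norm_mul, Real.norm_natCast, Real.norm_eq_abs]
    have h4 : ‖((n : ℝ) * a) • v‖ ≤ ‖(linY N M a B₁ n).mulVec v‖ + ‖B₁.mulVec v‖ := by
      rw [h2]
      exact (norm_sub_le _ _).trans' (by rw [add_sub_cancel_left])
    have h5 := hv v
    have h6 := norm_nonneg v
    rw [stepWeight, if_pos h, div_mul_eq_mul_div, le_div_iff₀ ha']
    nlinarith

theorem gevreyExponent_pos {N M : ℕ} (hN : 2 ≤ N) : 0 < gevreyExponent N M := by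
  rw [gevreyExponent]
  have h2 : (2 : ℝ) ≤ N := by exact_mod_cast hN
  split_ifs with h
  · exact one_div_pos.2 (by linarith)
  · have : (M : ℝ) < N := by exact_mod_cast not_le.1 h
    exact one_div_pos.2 (by linarith)

/-- The critical case is `m = M < N`: clearing denominators leaves `(M - 1)(N - M) ≤ s (M - 1)`,
which is where `s ≥ N - M` enters. -/
theorem exponent_le_of_order {N M m : ℕ} (hN : 2 ≤ N) (hM : 1 ≤ M) (hMN : M ≤ N)
    (hm : m = N ∨ m = M ∨ m = 1) (s : ℕ) (hs : 1 ≤ s) (hsm : N ≤ s + m) :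
    ((s + m - 1 : ℕ) : ℝ) / ((N : ℝ) - 1) ≤
      s * gevreyExponent N M + if m = N then 1 else 0 := by
  have hN2 : (2 : ℝ) ≤ N := by exact_mod_cast hN
  have hN1 : (0 : ℝ) < (N : ℝ) - 1 := by linarith
  have hM1 : (1 : ℝ) ≤ M := by exact_mod_cast hM
  have hs1 : (1 : ℝ) ≤ s := by exact_mod_cast hs
  have hsm' : (N : ℝ) ≤ s + m := by exact_mod_cast hsm
  have hγ : 1 / ((N : ℝ) - 1) ≤ gevreyExponent N M := by
    rw [gevreyExponent]
    split_ifs with h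
    · exact le_rfl
    · have : (M : ℝ) < N := by exact_mod_cast not_le.1 h
      exact one_div_le_one_div_of_le (by linarith) (by linarith)
  have hsγ : (s : ℝ) / ((N : ℝ) - 1) ≤ s * gevreyExponent N M := by
    rw [← mul_one_div]
    gcongr
  rw [Nat.cast_sub (by omega), Nat.cast_add, Nat.cast_one]
  by_cases h : m = N
  · rw [if_pos h, h, add_sub_assoc, add_div, div_self hN1.ne']
    linarith
  · rw [if_neg h, add_zero]
    rcases (hm.resolve_left h) with h1 | h1
    · have hlt : M < N := by omega
      have hlt' : (M : ℝ) < N := by exact_mod_cast hlt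
      rw [gevreyExponent, if_neg (by omega), mul_one_div, div_le_div_iff₀ hN1 (by linarith), h1]
      rw [h1] at hsm'
      nlinarith
    · simpa [h1] using hsγ

/-! ### The Gevrey estimate -/

section

variable {d d' : ℕ} {N M : ℕ} {a : ℝ} {B₁ : Matrix (Fin d) (Fin d) ℝ}
  {B₂ : Matrix (Fin d) (Fin d') ℝ} {C : Matrix (Fin d') (Fin d') ℝ}
  {ℓ : ((Fin d → ℝ) × (Fin d' → ℝ)) →L[ℝ] ℝ}
  {q : FormalMultilinearSeries ℝ (Phase d d') (Phase d d')}

theorem isGevrey_of_invResidual_eq_zero (hJ : IsSystemJet N M a B₁ B₂ C ℓ q) (ha : a ≠ 0)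
    (hC : IsUnit (C - 1)) (hB : M < N → IsUnit B₁) {b : ℝ} {K : ℕ → Phase d d'}
    (hK0 : K 0 = 0) (hK1 : K 1 = unitX)
    (hK : ∀ k, invResidual q (ContinuousLinearMap.id ℝ _) (reparam N a b).coeff K k = 0) :
    IsGevrey (gevreyExponent N M) K := by
  have hM := hJ.two_le
  have hMN := hJ.le
  have hN := hM.trans hMN
  have hr := isTangentSeries_reparam hN a b
  have ha' : 0 < |a| := abs_pos.2 ha
  set γ := gevreyExponent N M with hγdef
  have hγ0 : 0 < γ := gevreyExponent_pos hN
  obtain ⟨A, hA, β, hβ, hq⟩ := hJ.bound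
  let u : ℕ → ℝ := fun j => ‖K j‖ / (j ! : ℝ) ^ γ
  have hw : ∀ j : ℕ, 0 < (j ! : ℝ) ^ γ := fun j =>
    Real.rpow_pos_of_pos (by exact_mod_cast j.factorial_pos) _
  have hu0 : ∀ j, 0 ≤ u j := fun j => div_nonneg (norm_nonneg _) (hw j).le
  let G : ℝ := (N * Real.exp 1) ^ γ
  have hG : 0 < G := Real.rpow_pos_of_pos
    (mul_pos (by exact_mod_cast (by omega : 0 < N)) (Real.exp_pos 1)) _
  let ord : Fin 3 → ℕ := ![1, M, N]
  have hord : ∀ i, 1 ≤ ord i := by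
    intro i
    fin_cases i <;> simp [ord] <;> omega
  let X : ℕ → ℝ := fun n =>
    ∑ j ∈ Finset.Ico 1 n, G ^ (n - j) * u j + ∑ i, nonlinMajorant β u (ord i) n
  have hnl0 : ∀ m n, 0 ≤ nonlinMajorant β u m n := fun m n =>
    Finset.sum_nonneg fun l _ => Finset.sum_nonneg fun f _ =>
      mul_nonneg (pow_nonneg hβ.le _) (Finset.prod_nonneg fun i _ => hu0 _)
  have hX0 : ∀ n, 0 ≤ X n := fun n => add_nonneg
    (Finset.sum_nonneg fun j _ => mul_nonneg (pow_nonneg hG.le _) (hu0 j))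
    (Finset.sum_nonneg fun i _ => hnl0 _ _)
  have hcomp : ∀ {W : Type} [NormedAddCommGroup W] [NormedSpace ℝ W] (π : Phase d d' →L[ℝ] W)
      (i : Fin 3), (∀ l < ord i, π.compFormalMultilinearSeries q l = 0) →
      ∃ c > 0, ∀ n, 2 ≤ n → ‖invResidual (π.compFormalMultilinearSeries q) π
        (reparam N a b).coeff (truncSeq n K) (n + ord i - 1)‖ ≤
          c * (stepWeight N (ord i) n * ((n ! : ℝ) ^ γ * X n)) := by
    intro W _ _ π i hπ
    have hi : ord i = N ∨ ord i = M ∨ ord i = 1 := by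
      fin_cases i <;> simp [ord]
    -- The summand `1` keeps the constant positive when `π = 0`, as for `d = 0` or `d' = 0`.
    refine ⟨‖π‖ * A + Real.exp (|a| + |b|) * N * ‖π‖ + 1, by positivity, fun n hn => ?_⟩
    have hp : ∀ l, ‖π.compFormalMultilinearSeries q l‖ ≤ ‖π‖ * A * β ^ l := by
      intro l
      refine (π.norm_compContinuousMultilinearMap_le (q l)).trans ?_
      rw [mul_assoc]
      gcongr
      exact hq l
    have h1 := norm_invResidual_truncSeq_le (π.compFormalMultilinearSeries q) π hN (hord i)
      (by omega) a b hγ0.le (exponent_le_of_order hN (by omega) hMN hi) (by positivity) hβ.le hp hπ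
      hK0 (u := u) (fun _ => rfl) hn
    have hsw := one_le_stepWeight (N := N) (m := ord i) (n := n) (by omega)
    have h2 : ∑ j ∈ Finset.Ico 1 n, G ^ (n - j) * u j + nonlinMajorant β u (ord i) n ≤ X n := by
      simp only [X]
      gcongr
      exact Finset.single_le_sum (f := fun i => nonlinMajorant β u (ord i) n)
        (fun i _ => hnl0 _ _) (Finset.mem_univ i)
    have h3 := (hw n).le
    have h4 := hX0 n
    calc _ ≤ _ := h1
      _ ≤ (‖π‖ * A + Real.exp (|a| + |b|) * N * ‖π‖ + 1) *
          (stepWeight N (ord i) n * (n ! : ℝ) ^ γ * X n) := by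
        refine mul_le_mul (by linarith) (mul_le_mul_of_nonneg_left h2 (by positivity)) ?_
          (by positivity)
        exact mul_nonneg (by positivity) (add_nonneg
          (Finset.sum_nonneg fun j _ => mul_nonneg (pow_nonneg hG.le _) (hu0 j)) (hnl0 _ _))
      _ = _ := by ring
  obtain ⟨cx, hcx, hx⟩ := hcomp projX 2 hJ.order_x
  obtain ⟨cy, hcy, hy⟩ := hcomp projY 1 hJ.order_y
  obtain ⟨cz, hcz, hz⟩ := hcomp projZ 0 hJ.order_z
  obtain ⟨eC, heC, hC'⟩ := exists_norm_le_mulVec hC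
  obtain ⟨eB, heB, hB'⟩ := exists_norm_mulVec_le B₂
  obtain ⟨eY, heY, n₀, hY'⟩ := exists_stepWeight_mul_norm_le (B₁ := B₁) ha hMN hB
  have hsol := (invResidual_eq_zero_iff hJ hr hK0 hK1).1 hK
  let Dz := eC * cz
  let Dy := eY * (cy + eB * Dz)
  let Dx := 2 / |a| * (cx + ‖ℓ‖ * (Dy + Dz))
  have hDz : 0 < Dz := by positivity
  have hDy : 0 < Dy := by positivity
  have hDx : 0 < Dx := by positivity
  -- The bounds follow the triangular order z, y, x. Beyond `2N` one has `n - N ≥ n / 2`, so the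
  -- x-equation also gains a factor `n`.
  have hstep : ∀ n, 2 ≤ n → max n₀ (2 * N) < n → u n ≤ (Dx + Dy + Dz) * X n := by
    intro n hn hn0
    obtain ⟨ex, ey, ez⟩ := hsol n hn
    rw [resX_top hJ hr hK1 hn] at ex
    rw [resY_top hJ hr hK1 hn] at ey
    rw [resZ_top hJ hr hK1 hn] at ez
    let Y := (n ! : ℝ) ^ γ * X n
    have hY0 : 0 ≤ Y := mul_nonneg (hw n).le (hX0 n)
    have bz : ‖(K n).2.2‖ ≤ Dz * Y := by
      have h1 := hz n hn
      have h2 : ‖(C - 1).mulVec (K n).2.2‖ ≤ cz * Y := by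
        rw [eq_neg_of_add_eq_zero_left ez, norm_neg]
        refine h1.trans (le_of_eq ?_)
        simp [ord, stepWeight, show ¬ 1 = N by omega, Y]
      calc ‖(K n).2.2‖ ≤ eC * ‖(C - 1).mulVec (K n).2.2‖ := hC' _
        _ ≤ eC * (cz * Y) := by gcongr
        _ = Dz * Y := by simp only [Dz]; ring
    have by' : ‖(K n).2.1‖ ≤ Dy * Y := by
      have h1 : ‖resY q (reparam N a b).coeff (truncSeq n K) (n + M - 1)‖ ≤
          cy * (stepWeight N M n * Y) := hy n hn
      have hsw := one_le_stepWeight (N := N) (m := M) (n := n) (by omega)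
      have h2 : ‖(linY N M a B₁ n).mulVec (K n).2.1‖ ≤
          (cy + eB * Dz) * (stepWeight N M n * Y) := by
        rw [add_assoc] at ey
        rw [eq_neg_of_add_eq_zero_left ey, norm_neg]
        have h3 : ‖B₂.mulVec (K n).2.2‖ ≤ eB * (Dz * (stepWeight N M n * Y)) := by
          refine (hB' _).trans (mul_le_mul_of_nonneg_left (bz.trans ?_) heB.le)
          exact mul_le_mul_of_nonneg_left (le_mul_of_one_le_left hY0 hsw) hDz.le
        calc _ ≤ _ := norm_add_le _ _
          _ ≤ eB * (Dz * (stepWeight N M n * Y)) + cy * (stepWeight N M n * Y) := add_le_add h3 h1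
          _ = _ := by ring
      have h4 := hY' n (lt_of_le_of_lt (le_max_left _ _) hn0) (K n).2.1
      have h5 : stepWeight N M n * ‖(K n).2.1‖ ≤ stepWeight N M n * (Dy * Y) := by
        calc _ ≤ _ := h4
          _ ≤ eY * ((cy + eB * Dz) * (stepWeight N M n * Y)) := by gcongr
          _ = _ := by simp only [Dy]; ring
      exact le_of_mul_le_mul_left h5 (by linarith)
    have bx : ‖(K n).1‖ ≤ Dx * Y := by
      have hn2 : 2 * N < n := lt_of_le_of_lt (le_max_right _ _) hn0
      have hn2' : (2 : ℝ) * N < n := by exact_mod_cast hn2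
      have hn' : (0 : ℝ) < n := by exact_mod_cast (by omega : 0 < n)
      have hn1 : (1 : ℝ) ≤ n := by exact_mod_cast (by omega : 1 ≤ n)
      have h1 : ‖resX q (reparam N a b).coeff (truncSeq n K) (n + N - 1)‖ ≤
          cx * (stepWeight N N n * Y) := hx n hn
      rw [stepWeight, if_pos rfl] at h1
      have h2 : ‖ℓ (K n).2‖ ≤ ‖ℓ‖ * ((Dy + Dz) * (n * Y)) := by
        refine (ℓ.le_opNorm _).trans (mul_le_mul_of_nonneg_left ?_ (norm_nonneg _))
        have h3 : ‖(K n).2‖ ≤ Dy * Y + Dz * Y := by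
          rw [Prod.norm_def]
          exact max_le (by nlinarith) (by nlinarith)
        have h4 : Y ≤ n * Y := le_mul_of_one_le_left hY0 hn1
        nlinarith
      have h5 : ((n : ℝ) - N) * |a| * ‖(K n).1‖ ≤ (cx + ‖ℓ‖ * (Dy + Dz)) * (n * Y) := by
        have h6 : ‖((n : ℝ) - N) * a * (K n).1‖ = ((n : ℝ) - N) * |a| * ‖(K n).1‖ := by
          rw [norm_mul, norm_mul, Real.norm_of_nonneg (by linarith), Real.norm_eq_abs a]
        rw [← h6]
        rw [add_assoc] at ex
        rw [eq_neg_of_add_eq_zero_left ex, norm_neg]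
        calc _ ≤ _ := norm_add_le _ _
          _ ≤ ‖ℓ‖ * ((Dy + Dz) * (n * Y)) + cx * (n * Y) := add_le_add h2 h1
          _ = _ := by ring
      have h7 : (n : ℝ) / 2 * |a| * ‖(K n).1‖ ≤ (cx + ‖ℓ‖ * (Dy + Dz)) * (n * Y) := by
        refine le_trans ?_ h5
        gcongr
        linarith
      have h8 : ((n : ℝ) / 2 * |a|) * ‖(K n).1‖ ≤ ((n : ℝ) / 2 * |a|) * (Dx * Y) := by
        refine h7.trans (le_of_eq ?_)
        simp only [Dx]
        field_simp
      exact le_of_mul_le_mul_left h8 (by positivity)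
    have hKn : ‖K n‖ ≤ (Dx + Dy + Dz) * Y := by
      have e1 : 0 ≤ Dx * Y := by positivity
      have e2 : 0 ≤ Dy * Y := by positivity
      have e3 : 0 ≤ Dz * Y := by positivity
      rw [Prod.norm_def, Prod.norm_def]
      exact max_le (by linarith) (max_le (by linarith) (by linarith))
    rw [div_le_iff₀ (hw n)]
    refine hKn.trans (le_of_eq ?_)
    simp only [Y]
    ring
  have hu1 : u 1 ≤ 1 := by
    simp [u, hK1, unitX, Prod.norm_def]
  obtain ⟨ρ, hρ, h⟩ := exists_geometric_bound ord hord hu0 hu1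
    (by positivity : 0 < Dx + Dy + Dz) hG hβ (max n₀ (2 * N)) hstep
  refine ⟨1, one_pos, ρ, hρ, fun n => ?_⟩
  rcases Nat.eq_zero_or_pos n with hn | hn
  · simp [hn, hK0]
  · have := h n hn
    rw [div_le_iff₀ (hw n)] at this
    rwa [one_mul]

end

/-! ### Conclusion -/

theorem isUnit_sub_one_of_notMem_spectrum {n : ℕ} {C : Matrix (Fin n) (Fin n) ℝ}
    (hC : (1 : ℝ) ∉ spectrum ℝ C) : IsUnit (C - 1) := by
  have h := spectrum.notMem_iff.1 hC
  rw [map_one] at h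
  rw [← neg_sub]
  exact h.neg

theorem isFormalSolution_iff {d d' : ℕ} {F : Phase d d' → Phase d d'} {R : Polynomial ℝ} {N : ℕ}
    {c : ℝ} {K : ℕ → Phase d d'} : IsFormalSolution F R N c K ↔
      (K 0 = 0 ∧ K 1 = unitX ∧ (K N).1 = c ∧
        ∀ k, invResidual (deviationSeries F) (ContinuousLinearMap.id ℝ _) R.coeff K k = 0) := by
  rw [IsFormalSolution]
  refine and_congr_right fun h0 => ?_
  rw [formalInvariance_iff F R K h0]
  rfl

end

theorem theorem3p1 {d d' : ℕ} (N M : ℕ) (hN : 2 ≤ N) (hM : 2 ≤ M) (a : ℝ) (ha : a ≠ 0)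
    (B₁ : Matrix (Fin d) (Fin d) ℝ) (B₂ : Matrix (Fin d) (Fin d') ℝ)
    (C : Matrix (Fin d') (Fin d') ℝ) (hC : (1 : ℝ) ∉ spectrum ℝ C)
    (U : Set (Phase d d')) (F : Phase d d' → Phase d d')
    (hF : HasSystemForm N M a B₁ B₂ C U F)
    (hlt : M < N → IsUnit B₁)
    (heq : M = N → ∀ l : ℕ, 2 ≤ l →
      IsUnit (B₁ + ((l : ℝ) * a) • (1 : Matrix (Fin d) (Fin d) ℝ))) :
    ∃ R : Polynomial ℝ, IsReparametrization F N a R ∧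
      (∀ R' : Polynomial ℝ, IsReparametrization F N a R' → R' = R) ∧
      ∀ (c : ℝ) (K : ℕ → Phase d d'), IsFormalSolution F R N c K →
        IsGevrey (gevreyExponent N M) K := by
  obtain ⟨M', B₁', B₂', ℓ, hJ, hlt', heq', hγ⟩ := exists_isSystemJet hN hM ha hF hlt heq
  have hC' := isUnit_sub_one_of_notMem_spectrum hC
  have hlin : ∀ n, 2 ≤ n → IsUnit (linY N M' a B₁' n) := by
    intro n hn
    rw [linY]
    split_ifs with h
    · exact heq' h n hn
    · rw [add_zero]
      exact hlt' (lt_of_le_of_ne hJ.le h)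
  have hsol : ∀ b c K, IsFormalSolution F (reparam N a b) N c K ↔
      (∀ n, K n = solutionStep N M' a B₁' B₂' C ℓ (deviationSeries F) (reparam N a b).coeff c n
        (truncSeq n K)) ∧ resonance N ℓ (deviationSeries F) (reparam N a b).coeff K = 0 :=
    fun b c K => isFormalSolution_iff.trans
      (solution_iff hJ ha hC' hlin (isTangentSeries_reparam hN a b) c K)
  obtain ⟨K₀, hK₀⟩ := exists_truncSeq_recursion
    (solutionStep N M' a B₁' B₂' C ℓ (deviationSeries F) (reparam N a 0).coeff 0)
  -- `K₀` solves the recursion with `b = c = 0`, but not necessarily its resonance condition. As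
  -- resonance plus `b` is invariant, this value of `b` is the one that makes the resonance vanish
  -- for every `c`.
  let b := resonance N ℓ (deviationSeries F) (reparam N a 0).coeff K₀
  refine ⟨reparam N a b, ⟨⟨b, rfl⟩, fun c => ?_⟩, ?_, fun c K hK => ?_⟩
  · obtain ⟨K, hK⟩ := exists_truncSeq_recursion
      (solutionStep N M' a B₁' B₂' C ℓ (deviationSeries F) (reparam N a b).coeff c)
    refine ⟨K, (hsol b c K).2 ⟨hK, ?_⟩, fun K' hK' =>
      truncSeq_recursion_unique ((hsol b c K').1 hK').1 hK⟩
    have := resonance_add_eq hJ hK hK₀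
    simp only [b] at this ⊢
    linarith
  · rintro R' ⟨⟨b', rfl⟩, hR'⟩
    -- A single solution, here for `c = 0`, already forces the value of `b'`.
    obtain ⟨K, hK, -⟩ := hR' 0
    obtain ⟨hK, hres⟩ := (hsol b' 0 K).1 hK
    have := resonance_add_eq hJ hK hK₀
    have hb : b' = b := by
      simp only [b]
      linarith
    rw [hb]
    rfl
  · rw [hγ]
    obtain ⟨h0, h1, -, h⟩ := isFormalSolution_iff.1 hK
    exact isGevrey_of_invResidual_eq_zero hJ ha hC' hlt' h0 h1 h
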